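/- Throughout, rings are Noetherian. Let $(A,\mathfrak m)$ be a normal local domain of prime characteristic $p>0$ which is F-finite (the Frobenius endomorphism of $A$ is a finite map), let $Y=\operatorname{Spec}A$, let $L$ be the fraction field of $A$, and let $\Delta$ be an effective $\mathbb Q$-Weil divisor on $Y$. For a $\mathbb Q$-Weil divisor $D$ on $Y$ put $A(D)=\{g\in L : g=0 \text{ or } \operatorname{div}_Y(g)+D\ge 0\}$, and for $q=p^e$ write $A(D)^{1/q}\subset L^{1/q}$ for the set of $q$-th roots of elements of $A(D)$, an $A$-module. The pair $(A,\Delta)$ is *F-pure* if for every $q=p^e$ the inclusion $A\hookrightarrow A((q-1)\Delta)^{1/q}$ splits as a homomorphism of $A$-modules. It is *divisorially F-regular* if for every nonzero $c\in A$ that lies in no minimal prime of the ideal $A(-\lfloor\Delta\rfloor)\subseteq A$ there is $q=p^e$, $e\ge 1$, such that the $A$-linear map $A\to A((q-1)\Delta)^{1/q}$, $1\mapsto c^{1/q}$, splits. Let $f\colon X\to Y$ be a proper birational morphism with $X$ a normal integral scheme, and identify the function field of $X$ with $L$. Let $K_X$ and $K_Y$ be the canonical divisors of $X$ and $Y$ defined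 by one and the same embedding of the canonical sheaves in the constant sheaf $L$; that is, $K_X$ and $K_Y$ are the divisors on $X$ and $Y$ of one nonzero rational section of the top exterior power of the absolute Kähler differentials $\Omega_{L/\mathbb Z}$. (The canonical, or dualizing, sheaf of a normal F-finite scheme is the reflexive sheaf of top absolute differential forms.) Assume that $K_Y+\Delta$ is $\mathbb Q$-Cartier, let $\tilde\Delta$ be the strict transform of $\Delta$ in $X$, and define the discrepancies $a_j\in\mathbb Q$ by $$K_X+\tilde\Delta=f^*(K_Y+\Delta)+\sum_j a_jE_j,$$ where $E_j$ runs over the exceptional prime divisors of $f$, i.e. the prime divisors of $X$ whose image in $Y$ has codimension at least $2$. 1. If $(A,\Delta)$ is F-pure, then $a_j\ge -1$ for every $j$. 2. If $(A,\Delta)$ is divisorially F-regular, then $a_j>-1$ for every $j$. -/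

import Mathlib

open AlgebraicGeometry CategoryTheory

universe u

noncomputable section

namespace FPairs

/-! ### Normal schemes, birational morphisms, Weil divisors -/

/-- A scheme is normal if all its local rings are integrally closed domains. -/
class IsNormalScheme (X : Scheme.{u}) : Prop where
  isDomain_stalk : ∀ x : X, IsDomain (X.presheaf.stalk x)
  isIntegrallyClosed_stalk : ∀ x : X, IsIntegrallyClosed (X.presheaf.stalk x)

/-- A morphism `f : X ⟶ Y` is birational if it restricts to an isomorphism from a dense open
subscheme of `X` onto a dense open subscheme of `Y`. -/
class IsBirationalMorphism {X Y : Scheme.{u}} (f : X ⟶ Y) : Prop where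
  birationalOver : Scheme.BirationalOver f (𝟙 Y)

/-- A prime divisor, given by its generic point: a point of codimension one. -/
def PrimeDivisor (X : Scheme.{u}) : Type u := {x : X // Order.coheight x = 1}

/-- Weil divisors with coefficients in `R` (used for `R = ℤ` and `R = ℚ`) on a Noetherian
scheme: finite formal sums of prime divisors. -/
abbrev WeilDivisor (X : Scheme.{u}) (R : Type) [Zero R] : Type u := PrimeDivisor X →₀ R

/-- The round-down of a `ℚ`-divisor, coefficient by coefficient. -/
def roundDown {X : Scheme.{u}} (D : WeilDivisor X ℚ) : WeilDivisor X ℚ :=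
  D.mapRange (fun t => ((⌊t⌋ : ℤ) : ℚ)) (by simp)

/-- An integral divisor regarded as a `ℚ`-divisor. -/
def toRat {X : Scheme.{u}} (K : WeilDivisor X ℤ) : WeilDivisor X ℚ :=
  K.mapRange (fun n : ℤ => (n : ℚ)) (by simp)

/-- The local ring of a normal locally Noetherian integral scheme at a prime divisor is a
discrete valuation ring. -/
theorem isDiscreteValuationRing_stalk (X : Scheme.{u}) [IsIntegral X] [IsLocallyNoetherian X]
    [IsNormalScheme X] (E : PrimeDivisor X) :
    IsDiscreteValuationRing (X.presheaf.stalk E.1) := by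
  have hdim : ringKrullDim (X.presheaf.stalk E.1) = 1 := by
    rw [ringKrullDim_stalk_eq_coheight, E.2]; rfl
  have : Ring.KrullDimLE 1 (X.presheaf.stalk E.1) := krullDimLE_of_coheight_le E.2.le
  have : IsIntegrallyClosed (X.presheaf.stalk E.1) := IsNormalScheme.isIntegrallyClosed_stalk _
  have hnf : ¬ IsField (X.presheaf.stalk E.1) := by
    intro h
    have h0 := ringKrullDim_eq_zero_of_isField h
    rw [hdim] at h0
    exact one_ne_zero h0
  refine ((IsDiscreteValuationRing.TFAE (X.presheaf.stalk E.1) hnf).out 0 3).mpr ?_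
  refine ⟨inferInstance, IsLocalRing.maximalIdeal _, ⟨?_, inferInstance⟩, ?_⟩
  · intro h
    exact hnf (IsLocalRing.isField_iff_maximalIdeal_eq.mpr h)
  · rintro P ⟨hP, hP'⟩
    exact IsLocalRing.eq_maximalIdeal (hP'.isMaximal_of_ne_bot hP)

/-- The spectrum of an integrally closed domain is a normal scheme. -/
instance isNormalScheme_Spec (A : Type u) [CommRing A] [IsDomain A] [IsIntegrallyClosed A] :
    IsNormalScheme (Spec (.of A)) where
  isDomain_stalk x := inferInstance
  isIntegrallyClosed_stalk x := by
    let y : PrimeSpectrum A := x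
    have := StructureSheaf.IsLocalization.to_stalk A y
    exact isIntegrallyClosed_of_isLocalization (R := A)
      ((Spec.structureSheaf A).presheaf.stalk y) y.asIdeal.primeCompl
      y.asIdeal.primeCompl_le_nonZeroDivisors

/-- A birational morphism is dominant. -/
instance isDominant_of_isBirationalMorphism {X Y : Scheme.{u}} (f : X ⟶ Y)
    [hf : IsBirationalMorphism f] : IsDominant f := by
  obtain ⟨e, he⟩ := hf.birationalOver
  have : IsDominant e.target.ι := Opens.isDominant_ι e.dense_target
  have h : e.iso.hom ≫ e.target.ι = e.source.ι ≫ f := by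
    simpa [Scheme.PartialIso.IsOver] using he
  have : IsDominant (e.source.ι ≫ f) := h ▸ inferInstance
  exact IsDominant.of_comp e.source.ι f

/-- A dominant morphism of integral schemes sends the generic point to the generic point. -/
theorem map_genericPoint {X Y : Scheme.{u}} [IsIntegral X] [IsIntegral Y] (f : X ⟶ Y)
    [IsDominant f] : f (genericPoint X) = genericPoint Y := by
  refine ((genericPoint_spec Y).eq ?_).symm
  have := (genericPoint_spec X).image f.continuous
  rwa [Set.image_univ, f.denseRange.closure_range] at this

/-- The homomorphism `K(Y) → K(X)` of function fields induced by a dominant morphism. -/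
def functionFieldMap {X Y : Scheme.{u}} [IsIntegral X] [IsIntegral Y] (f : X ⟶ Y)
    [IsDominant f] : Y.functionField →+* X.functionField :=
  (Y.presheaf.stalkSpecializes (specializes_of_eq (map_genericPoint f)) ≫
    f.stalkMap (genericPoint X)).hom

section Cartier

variable {X Y : Scheme.{u}} [IsIntegral X] [IsIntegral Y] [IsLocallyNoetherian X]
  [IsLocallyNoetherian Y]

/-- `w` is a local equation of the divisor `D` at `y`: on some open neighbourhood of `y` the
divisor `D` is the divisor of the nonzero rational function `w`. -/
def IsLocalEquation (D : WeilDivisor Y ℚ) (y : Y) (w : Y.functionField) : Prop :=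
  w ≠ 0 ∧ ∃ U : Y.Opens, y ∈ U ∧ ∀ P : PrimeDivisor Y, P.1 ∈ U → D P = (Scheme.ord w P.1 : ℚ)

/-- A divisor is Cartier if it has a local equation at every point (in particular, its
coefficients are integers). -/
def IsCartier (D : WeilDivisor Y ℚ) : Prop := ∀ y : Y, ∃ w, IsLocalEquation D y w

/-- A `ℚ`-divisor is `ℚ`-Cartier if some positive integral multiple of it is Cartier. -/
def IsQCartier (D : WeilDivisor Y ℚ) : Prop := ∃ r : ℕ, 0 < r ∧ IsCartier ((r : ℚ) • D)

/-- `D'` is (the family of coefficients of) the pull-back `f^* D = (1/r) f^*(r D)`: the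
coefficient of `f^* D` along `E` is `1/r` times the order along `E` of the pull-back of a local
equation of `r D` at the image of the generic point of `E`. -/
def IsPullback (f : X ⟶ Y) [IsDominant f] (D : WeilDivisor Y ℚ) (D' : PrimeDivisor X → ℚ) :
    Prop :=
  ∀ E : PrimeDivisor X, ∃ r : ℕ, ∃ w : Y.functionField, 0 < r ∧
    IsLocalEquation ((r : ℚ) • D) (f E.1) w ∧
    D' E = (Scheme.ord (functionFieldMap f w) E.1 : ℚ) / r

end Cartier

/-- A prime divisor `E` of `X` is exceptional for `f : X ⟶ Y` if its image has codimension at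
least two in `Y`. -/
def IsExceptional {X Y : Scheme.{u}} (f : X ⟶ Y) (E : PrimeDivisor X) : Prop :=
  2 ≤ Order.coheight (f E.1)

open Classical in
/-- (The family of coefficients of) the strict transform of `D` under a birational morphism
`f : X ⟶ Y`: the coefficient along `E` is that of `D` along the image of `E` if this image is a
prime divisor, and is zero otherwise. -/
def strictTransform {X Y : Scheme.{u}} (f : X ⟶ Y) (D : WeilDivisor Y ℚ) (E : PrimeDivisor X) :
    ℚ :=
  if h : Order.coheight (f E.1) = 1 then D ⟨f E.1, h⟩ else 0

/-! ### Canonical divisors -/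

/-- Top differential forms of a field `L`: the top exterior power of the module of absolute
Kähler differentials of `L`. If `L` has characteristic `p` and `[L : L ^ p] = p ^ n`, then
`Ω[L⁄ℤ]` has dimension `n` and top forms are a one-dimensional space. -/
abbrev TopForm (L : Type u) [Field L] : Type u := ⋀[L]^(Module.finrank L Ω[L⁄ℤ]) Ω[L⁄ℤ]

/-- The top forms of `L` that are regular along a subring `R`: the image in `TopForm L` of the
exterior power of `Ω[R⁄ℤ]`, that is, the `R`-span of the forms `ds₁ ∧ ⋯ ∧ dsₙ`, `sᵢ ∈ R`. -/
def regularForms {L : Type u} [Field L] (R : Subring L) : Submodule R (TopForm L) :=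
  Submodule.span R {ω | ∃ s : Fin (Module.finrank L Ω[L⁄ℤ]) → R,
    ω = exteriorPower.ιMulti L _ (fun i => KaehlerDifferential.D ℤ L (s i : L))}

/-- `K` is the canonical divisor of the normal scheme `X` attached to the nonzero rational top
form `η`. The form gives an embedding of the canonical sheaf of `X` (the reflexive sheaf `ω` of
top differential forms, which is the dualizing sheaf when `X` is F-finite) in the constant sheaf
of rational functions, and `K` is the divisor such that `𝒪(K) = ω`: for every prime divisor `E`
and every rational function `g`, the form `g η` is regular along `E` if and only if `g` lies in
the stalk of `𝒪(K)` at `E`.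

Forms live over a field `L` with an identification `ι : K(X) ≅ L`, so that canonical divisors of
birational schemes can be attached to the same form. -/
def IsCanonicalDivisor (X : Scheme.{u}) [IsIntegral X] [IsLocallyNoetherian X] {L : Type u}
    [Field L] (ι : X.functionField →+* L) (η : TopForm L) (K : WeilDivisor X ℤ) : Prop :=
  ∀ (E : PrimeDivisor X) (g : X.functionField),
    ι g • η ∈ regularForms (ι.comp (algebraMap (X.presheaf.stalk E.1) X.functionField)).range ↔
      (g = 0 ∨ 0 ≤ Scheme.ord g E.1 + K E)

/-! ### F-singularities of pairs -/

section Pairs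

/-- `A` is F-finite: the Frobenius endomorphism of `A` is a finite map. -/
def IsFFinite (p : ℕ) (A : Type u) [CommRing A] [ExpChar A p] : Prop :=
  (frobenius A p).Finite

/-- The module `M ^ {1/q}`, `q = p ^ e`: a copy of `M`, whose elements are written `x ^ {1/q}`,
with the action `a • x ^ {1/q} = (a ^ q • x) ^ {1/q}`. -/
def Root (_p _e : ℕ) (M : Type u) : Type u := M

instance (p e : ℕ) (M : Type u) [AddCommGroup M] : AddCommGroup (Root p e M) :=
  inferInstanceAs (AddCommGroup M)

instance (p e : ℕ) (A M : Type u) [CommRing A] [ExpChar A p] [AddCommGroup M] [Module A M] :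
    Module A (Root p e M) :=
  Module.compHom (R := A) (S := A) M (iterateFrobenius A p e)

/-- The element `x ^ {1/q}` of `M ^ {1/q}`. -/
def root (p e : ℕ) {M : Type u} (x : M) : Root p e M := x

/-- The `A`-linear map `A → M` sending `1` to `x` splits. -/
def Splits (A : Type u) {M : Type u} [CommRing A] [AddCommGroup M] [Module A M] (x : M) : Prop :=
  ∃ ψ : M →ₗ[A] A, ψ ∘ₗ LinearMap.toSpanSingleton A M x = LinearMap.id

variable (p : ℕ) {A : Type u} [CommRing A] [IsDomain A] [IsNoetherianRing A]
  [IsIntegrallyClosed A] [ExpChar A p]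

/-- The function field of `Spec A` as an `A`-algebra. -/
instance algebraFunctionField (A : Type u) [CommRing A] [IsDomain A] :
    Algebra A (Spec (.of A)).functionField :=
  (((Spec (.of A)).presheaf.germ ⊤ (genericPoint _) trivial).hom.comp (Scheme.ΓSpecIso (.of A)).inv.hom).toAlgebra

/-- `A(D) = {g ∈ K(Y) | div(g) + D ≥ 0}` for a `ℚ`-divisor `D` on `Y = Spec A`. -/
def sections (D : WeilDivisor (Spec (.of A)) ℚ) :
    Submodule A (Spec (.of A)).functionField where
  carrier := {g | g ≠ 0 → ∀ P : PrimeDivisor (Spec (.of A)), 0 ≤ (Scheme.ord g P.1 : ℚ) + D P}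
  zero_mem' := fun h => absurd rfl h
  add_mem' := by
    intro g h hg hh hgh P
    by_cases hg0 : g = 0
    · subst hg0
      simpa using hh (by simpa using hgh) P
    by_cases hh0 : h = 0
    · subst hh0
      simpa using hg (by simpa using hgh) P
    have : IsDiscreteValuationRing ((Spec (.of A)).presheaf.stalk P.1) :=
      isDiscreteValuationRing_stalk _ P
    have h1 := Scheme.ord_add (x := P.1) hgh
    have h2 := hg hg0 P
    have h3 := hh hh0 P
    rcases min_le_iff.mp h1 with h4 | h4
    · have : (Scheme.ord g P.1 : ℚ) ≤ (Scheme.ord (g + h) P.1 : ℚ) := by exact_mod_cast h4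
      linarith
    · have : (Scheme.ord h P.1 : ℚ) ≤ (Scheme.ord (g + h) P.1 : ℚ) := by exact_mod_cast h4
      linarith
  smul_mem' := by
    intro a g hg hag P
    have hg0 : g ≠ 0 := fun h => hag (by rw [h, smul_zero])
    have : Nonempty (⊤ : (Spec (.of A)).Opens) := ⟨⟨genericPoint _, trivial⟩⟩
    have e : a • g = ((Scheme.ΓSpecIso (.of A)).inv.hom a) • g := rfl
    have ha0 : (Scheme.ΓSpecIso (.of A)).inv.hom a ≠ 0 := fun h => hag (by rw [e, h, zero_smul])
    have h1 := Scheme.ord_le_smul (x := P.1) (U := (⊤ : (Spec (.of A)).Opens)) trivial ha0 g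
    have h2 := hg hg0 P
    rw [← e] at h1
    have : (Scheme.ord g P.1 : ℚ) ≤ (Scheme.ord (a • g) P.1 : ℚ) := by exact_mod_cast h1
    linarith

/-- The ideal `A(-⌊Δ⌋)` of `A`. -/
def floorIdeal (Δ : WeilDivisor (Spec (.of A)) ℚ) : Ideal A :=
  (sections (-roundDown Δ)).comap (Algebra.linearMap A (Spec (.of A)).functionField)

/-- For `q = p ^ e`, the map `c ^ {1/q} A ↪ A((q - 1)Δ) ^ {1/q}` (is defined and) splits as a
homomorphism of `A`-modules. -/
def FrobeniusSplits (Δ : WeilDivisor (Spec (.of A)) ℚ) (e : ℕ) (c : A) : Prop :=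
  ∃ h : algebraMap A (Spec (.of A)).functionField c ∈ sections (((p : ℚ) ^ e - 1) • Δ),
    Splits A (root p e (⟨_, h⟩ : sections (((p : ℚ) ^ e - 1) • Δ)))

/-- The pair `(A, Δ)` is F-pure. -/
def IsFPure (Δ : WeilDivisor (Spec (.of A)) ℚ) : Prop :=
  ∀ e : ℕ, FrobeniusSplits p Δ e 1

/-- The pair `(A, Δ)` is divisorially F-regular. -/
def IsDivisoriallyFRegular (Δ : WeilDivisor (Spec (.of A)) ℚ) : Prop :=
  ∀ c : A, c ≠ 0 → (∀ 𝔭 ∈ (floorIdeal Δ).minimalPrimes, c ∉ 𝔭) →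
    ∃ e : ℕ, 0 < e ∧ FrobeniusSplits p Δ e c

end Pairs

end FPairs

end

/-! A splitting is converted into one rational function, whose divisor is then estimated on `Y` and
on `X`. Put `q = p ^ e`. A splitting is a `q⁻¹`-linear map on `A((q - 1)Δ)` sending `c` to `1`; it
extends to a map `Ψ` of the function field. Top forms of `L` are one-dimensional, and the iterated
Cartier operator `C^[e]` generates the `q⁻¹`-linear endomorphisms of `L`. So there is one `x` with
`C^[e] (x g η) = Ψ(g) η` for all `g` (`IsCartierOperator.exists_iterate_mul_smul`).

On `Y`, `Ψ` maps sections of `(q - 1)Δ` to regular functions, and duality for `C` at each prime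
divisor gives `div x ≥ (q - 1) K_Y + ⌊(q - 1)Δ⌋` (`le_ord_of_iterate_mem`). On `X`, `C` preserves
forms regular along `E`, and `C^[e] (x c η) = η` forces `ord_E (x c) + K_X(E) < q (K_X(E) + 1)`
(`ord_add_lt_of_iterate_eq`). If `b` vanishes on every component of `Δ`, multiplication by `b`
undoes the rounding: `div (x b) ≥ (q - 1)(K_Y + Δ)`. Since `Y` is normal, this inequality pulls back
to `X`. For exceptional `E` the two bounds combine to `(q - 1)(-1 - a_E) ≤ ord_E b - ord_E c`
(`FrobeniusSplits.mul_le_ord_sub_ord`), with `b` independent of `q`.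

F-purity allows `c = 1` and `q → ∞`, so `a_E ≥ -1`. Under divisorial F-regularity, `c` may be a high
power of an element vanishing at `f(E)` but on no component of `⌊Δ⌋`; the right side is then
negative, so a single `e ≥ 1` gives `a_E > -1`.

The Cartier operator is built by hand from `p`-bases. An F-finite discrete valuation ring has a
`p`-basis, which is also one of its fraction field; this controls `C` on regular forms. The local
rings of `X` at prime divisors are F-finite because they are essentially of finite type over `A`. -/

noncomputable section

namespace FPairs


/-! ### p-bases -/

section PBasis

/-- The monomial `z ^ m`. -/
def mono {ι R : Type*} [Fintype ι] [CommRing R] (z : ι → R) (m : ι → ℕ) : R := ∏ i, z i ^ m i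

/-- A finite family `z` is a `p`-basis of a ring of characteristic `p` if every element is
uniquely a combination, with `p`-th powers as coefficients, of the monomials in `z` with exponents
less than `p`. -/
def IsPBasis (p : ℕ) {ι R : Type*} [Fintype ι] [DecidableEq ι] [CommRing R] (z : ι → R) : Prop :=
  Function.Bijective fun c : (ι → Fin p) → R => ∑ α, c α ^ p * mono z fun i => (α i : ℕ)

variable {ι R : Type*} [Fintype ι] [CommRing R]

theorem mono_add (z : ι → R) (m m' : ι → ℕ) : mono z (m + m') = mono z m * mono z m' := by
  simp [mono, pow_add, Finset.prod_mul_distrib]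

theorem mono_smul (z : ι → R) (k : ℕ) (m : ι → ℕ) : mono z (k • m) = mono z m ^ k := by
  simp [mono, ← Finset.prod_pow, mul_comm k, pow_mul]

@[simp] theorem mono_zero (z : ι → R) : mono z 0 = 1 := by simp [mono]

theorem mono_sum {κ : Type*} (s : Finset κ) (z : ι → R) (m : κ → ι → ℕ) :
    mono z (∑ k ∈ s, m k) = ∏ k ∈ s, mono z (m k) := by
  classical
  induction s using Finset.induction_on with
  | empty => simp
  | insert a s ha ih => rw [Finset.sum_insert ha, Finset.prod_insert ha, mono_add, ih]

theorem map_mono {S F : Type*} [CommRing S] [FunLike F R S] [RingHomClass F R S] (f : F)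
    (z : ι → R) (m : ι → ℕ) : f (mono z m) = mono (fun i => f (z i)) m := by
  simp [mono, map_prod]

variable [DecidableEq ι]

theorem mono_single (z : ι → R) (i : ι) : mono z (Pi.single i 1) = z i := by
  rw [mono, Finset.prod_eq_single i] <;> simp +contextual

/-- An additive property of families that holds for families in a generating set of the additive
monoid holds for all families. -/
theorem forall_of_update_add {M : Type*} [AddCommMonoid M] {G : Set M}
    (hG : AddSubmonoid.closure G = ⊤) (h0 : (0 : M) ∈ G) {P : (ι → M) → Prop}
    (hadd : ∀ u i x y, P (Function.update u i x) → P (Function.update u i y) →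
      P (Function.update u i (x + y)))
    (hP : ∀ u, (∀ i, u i ∈ G) → P u) (u : ι → M) : P u := by
  -- Induction on the set of slots whose entries are allowed to leave `G`.
  suffices H : ∀ s : Finset ι, ∀ u : ι → M, (∀ i ∉ s, u i ∈ G) → P u from
    H Finset.univ u (by simp)
  intro s
  induction s using Finset.induction_on with
  | empty => exact fun u hu => hP u fun i => hu i (by simp)
  | insert i s hi ih =>
    intro u hu
    have key : ∀ x ∈ AddSubmonoid.closure G, P (Function.update u i x) := by
      intro x hx
      have hx' : ∀ x ∈ G, P (Function.update u i x) := by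
        intro x hx
        refine ih _ fun j hj => ?_
        by_cases hji : j = i
        · subst hji; simpa using hx
        · simpa [hji] using hu j (by simp [hji, hj])
      induction hx using AddSubmonoid.closure_induction with
      | mem x hx => exact hx' x hx
      | zero => exact hx' 0 h0
      | add x y _ _ h1 h2 => exact hadd u i x y h1 h2
    simpa using key (u i) (by simp [hG])

namespace IsPBasis

variable {p : ℕ} {z : ι → R} (hz : IsPBasis p z)

/-- The coefficients of an element with respect to a `p`-basis (they appear to the power `p`). -/
def coeff (α : ι → Fin p) (x : R) : R := (Equiv.ofBijective _ hz).symm x α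

theorem sum_coeff (x : R) : ∑ α, hz.coeff α x ^ p * mono z (fun i => (α i : ℕ)) = x :=
  (Equiv.ofBijective _ hz).apply_symm_apply x

theorem coeff_eq {x : R} {c : (ι → Fin p) → R}
    (h : ∑ α, c α ^ p * mono z (fun i => (α i : ℕ)) = x) (α : ι → Fin p) : hz.coeff α x = c α := by
  have : (Equiv.ofBijective _ hz) c = x := h
  rw [coeff, ← this, Equiv.symm_apply_apply]

variable [Fact p.Prime] [CharP R p]

theorem coeff_add (α : ι → Fin p) (x y : R) :
    hz.coeff α (x + y) = hz.coeff α x + hz.coeff α y := by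
  refine hz.coeff_eq (c := fun α => hz.coeff α x + hz.coeff α y) ?_ α
  simp only [add_pow_char, add_mul, Finset.sum_add_distrib, hz.sum_coeff]

omit [Fact p.Prime] [CharP R p] in
theorem coeff_pow_mul (α : ι → Fin p) (a x : R) :
    hz.coeff α (a ^ p * x) = a * hz.coeff α x := by
  refine hz.coeff_eq (c := fun α => a * hz.coeff α x) ?_ α
  simp only [mul_pow, mul_assoc, ← Finset.mul_sum, hz.sum_coeff]

-- Dividing all exponents by `p` with remainder gives `z ^ m = (z ^ (m / p)) ^ p * z ^ (m % p)`, a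
-- single term of the expansion.
omit [CharP R p] in
theorem coeff_mono (α : ι → Fin p) (m : ι → ℕ) :
    hz.coeff α (mono z m) = if (fun i => (α i : ℕ)) = fun i => m i % p then
      mono z (fun i => m i / p) else 0 := by
  have hp : 0 < p := (Fact.out : p.Prime).pos
  let β : ι → Fin p := fun i => ⟨m i % p, Nat.mod_lt _ hp⟩
  have e : (fun i => (α i : ℕ)) = (fun i => m i % p) ↔ α = β := by
    simp only [funext_iff, Fin.ext_iff, β]
  simp only [e]
  refine hz.coeff_eq (c := fun α => if α = β then mono z (fun i => m i / p) else 0) ?_ α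
  rw [Finset.sum_eq_single β]
  · rw [if_pos rfl, ← mono_smul, ← mono_add]
    congr 1
    funext i
    exact Nat.div_add_mod (m i) p
  · intro b _ hb
    simp [hb, hp.ne']
  · simp

-- Reduces additive identities to the elements `c ^ p * z ^ m`, on which derivations and forms are
-- explicit.
omit [Fact p.Prime] [CharP R p] in
include hz in
theorem closure_monomials :
    AddSubmonoid.closure {x : R | ∃ (c : R) (m : ι → ℕ), x = c ^ p * mono z m} = ⊤ := by
  refine eq_top_iff.mpr fun x _ => ?_
  rw [← hz.sum_coeff x]
  exact sum_mem fun α _ => AddSubmonoid.subset_closure ⟨_, _, rfl⟩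

-- As `p > 1`, `z i` is itself one of the basis monomials, so one of its coefficients is `1`.
omit [CharP R p] in
include hz in
theorem ne_zero [Nontrivial R] (i : ι) : z i ≠ 0 := by
  intro h
  have hp := (Fact.out : p.Prime)
  have h0 : ∀ α, hz.coeff α (0 : R) = 0 := fun α => by
    simpa using hz.coeff_pow_mul α 0 0
  have h1 := hz.coeff_mono (fun j => if j = i then ⟨1, hp.one_lt⟩ else ⟨0, hp.pos⟩) (Pi.single i 1)
  rw [mono_single, h, h0, if_pos] at h1
  · have : (fun j => (Pi.single i 1 : ι → ℕ) j / p) = 0 := by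
      funext j
      by_cases hj : j = i
      · subst hj; simp [hp.one_lt]
      · simp [hj]
    rw [this, mono_zero] at h1
    exact one_ne_zero h1.symm
  · funext j
    by_cases hj : j = i
    · subst hj; simp [Nat.mod_eq_of_lt hp.one_lt]
    · simp [hj]

omit [Fact p.Prime] [CharP R p] in
theorem coeff_zero (α : ι → Fin p) : hz.coeff α 0 = 0 := by simpa using hz.coeff_pow_mul α 0 0

/-- The logarithmic derivation `z_j ∂ / ∂ z_j` attached to a `p`-basis. -/
def logDer (j : ι) : R →+ R where
  toFun x := ∑ α, (α j : ℕ) * (hz.coeff α x ^ p * mono z (fun i => (α i : ℕ)))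
  map_zero' := by simp [hz.coeff_zero, (Fact.out : p.Prime).ne_zero]
  map_add' x y := by simp only [hz.coeff_add, add_pow_char, add_mul, mul_add, Finset.sum_add_distrib]

/-- The elements `c ^ p * z ^ m` are eigenvectors; reducing the exponent modulo `p` does not change
its image in `R`. -/
theorem logDer_pow_mul_mono (j : ι) (c : R) (m : ι → ℕ) :
    hz.logDer j (c ^ p * mono z m) = (m j : R) * (c ^ p * mono z m) := by
  have hp : 0 < p := (Fact.out : p.Prime).pos
  let β : ι → Fin p := fun i => ⟨m i % p, Nat.mod_lt _ hp⟩
  have e : ∀ α : ι → Fin p, (fun i => (α i : ℕ)) = (fun i => m i % p) ↔ α = β := fun α => by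
    simp only [funext_iff, Fin.ext_iff, β]
  simp only [logDer, AddMonoidHom.coe_mk, ZeroHom.coe_mk, hz.coeff_pow_mul, hz.coeff_mono, e]
  rw [Finset.sum_eq_single β]
  · have h1 : ((β j : ℕ) : R) = m j := by
      simp only [β]
      rw [CharP.cast_eq_iff_mod_eq R p] 
      exact Nat.mod_mod _ _
    rw [if_pos rfl, h1, mul_pow, ← mono_smul, mul_assoc, ← mono_add]
    congr 4
    funext i
    exact Nat.div_add_mod (m i) p
  · intro b _ hb
    simp [hb, hp.ne']
  · simp

/-- Exponents, that is eigenvalues, add under multiplication, which is the Leibniz rule on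
generators; both sides are biadditive. -/
theorem logDer_mul (j : ι) (x y : R) :
    hz.logDer j (x * y) = x * hz.logDer j y + y * hz.logDer j x := by
  have hx : x ∈ AddSubmonoid.closure {x : R | ∃ (c : R) (m : ι → ℕ), x = c ^ p * mono z m} := by
    simp [hz.closure_monomials]
  have hy : y ∈ AddSubmonoid.closure {x : R | ∃ (c : R) (m : ι → ℕ), x = c ^ p * mono z m} := by
    simp [hz.closure_monomials]
  induction hx using AddSubmonoid.closure_induction with
  | zero => simp
  | add x x' _ _ h1 h2 => rw [add_mul, map_add, h1, h2, map_add]; ring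
  | mem x hx =>
    induction hy using AddSubmonoid.closure_induction with
    | zero => simp
    | add y y' _ _ h1 h2 => rw [mul_add, map_add, h1, h2, map_add]; ring
    | mem y hy =>
      obtain ⟨c, m, rfl⟩ := hx
      obtain ⟨c', m', rfl⟩ := hy
      have : c ^ p * mono z m * (c' ^ p * mono z m') = (c * c') ^ p * mono z (m + m') := by
        rw [mono_add]; ring
      rw [this, logDer_pow_mul_mono, logDer_pow_mul_mono, logDer_pow_mul_mono, ← this]
      push_cast [Pi.add_apply]
      ring

/-- The logarithmic derivation as a derivation. -/
def logDerivation (j : ι) : Derivation ℤ R R :=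
  Derivation.mk' (hz.logDer j).toIntLinearMap fun a b => by
    simpa using hz.logDer_mul j a b

theorem logDerivation_apply (i j : ι) : hz.logDerivation j (z i) = if i = j then z i else 0 := by
  have := hz.logDer_pow_mul_mono j 1 (Pi.single i 1)
  rw [one_pow, one_mul, mono_single] at this
  refine Eq.trans this ?_
  by_cases h : i = j
  · subst h; simp
  · simp [h, Ne.symm h]

end IsPBasis

end PBasis


/-! ### Differentials and p-bases -/

section Differentials

open KaehlerDifferential

theorem D_pow_char (p : ℕ) {L : Type*} [CommRing L] [CharP L p] (c : L) : D ℤ L (c ^ p) = 0 := by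
  rw [Derivation.leibniz_pow, ← Nat.cast_smul_eq_nsmul L, CharP.cast_eq_zero, zero_smul]

theorem D_pow_char_mul (p : ℕ) {L : Type*} [CommRing L] [CharP L p] (c x : L) :
    D ℤ L (c ^ p * x) = c ^ p • D ℤ L x := by
  rw [Derivation.leibniz, D_pow_char, smul_zero, add_zero]

variable {L : Type u} [Field L]

/-- The logarithmic differential of a monomial. -/
theorem D_mono {ι : Type*} [Fintype ι] {z : ι → L} (hz : ∀ i, z i ≠ 0) (m : ι → ℕ) :
    D ℤ L (mono z m) = mono z m • ∑ j, (m j : L) • (z j)⁻¹ • D ℤ L (z j) := by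
  classical
  rw [mono]
  induction (Finset.univ : Finset ι) using Finset.induction_on with
  | empty => simp
  | insert a s ha ih =>
    have h : D ℤ L (z a ^ m a) = z a ^ m a • (m a : L) • (z a)⁻¹ • D ℤ L (z a) := by
      rcases Nat.eq_zero_or_pos (m a) with h | h
      · simp [h]
      · obtain ⟨k, hk⟩ := Nat.exists_eq_add_of_lt h
        rw [Derivation.leibniz_pow, ← Nat.cast_smul_eq_nsmul L, smul_smul, smul_smul, smul_smul, hk]
        congr 1
        simp only [zero_add, Nat.add_sub_cancel, pow_succ]
        field_simp [hz a]
    rw [Finset.prod_insert ha, Finset.sum_insert ha, Derivation.leibniz, ih, h]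
    simp only [smul_add, smul_smul]
    rw [add_comm]
    congr 2
    ring

variable {p : ℕ} [Fact p.Prime] [CharP L p]

section

variable {ι : Type*} [Fintype ι] [DecidableEq ι] {z : ι → L} (hz : IsPBasis p z)

-- The logarithmic derivations, lifted to the differentials, form a dual family.
include hz in
theorem IsPBasis.linearIndependent_dlog :
    LinearIndependent L fun i => (z i)⁻¹ • D ℤ L (z i) := by
  rw [Fintype.linearIndependent_iff]
  intro g hg j
  have := congrArg (hz.logDerivation j).liftKaehlerDifferential hg
  simp only [map_sum, map_smul, Derivation.liftKaehlerDifferential_comp_D, map_zero,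
    hz.logDerivation_apply] at this
  simpa [hz.ne_zero] using this

include hz in
theorem IsPBasis.span_dlog :
    Submodule.span L (Set.range fun i => (z i)⁻¹ • D ℤ L (z i)) = ⊤ := by
  rw [eq_top_iff, ← KaehlerDifferential.span_range_derivation, Submodule.span_le]
  rintro _ ⟨x, rfl⟩
  rw [← hz.sum_coeff x, map_sum]
  refine sum_mem fun α _ => ?_
  rw [D_pow_char_mul, D_mono hz.ne_zero]
  refine Submodule.smul_mem _ _ (Submodule.smul_mem _ _ (sum_mem fun j _ => ?_))
  exact Submodule.smul_mem _ _ (Submodule.subset_span ⟨j, rfl⟩)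

/-- The logarithmic differentials of a `p`-basis form a basis of the differentials. -/
def IsPBasis.dlogBasis : Module.Basis ι L Ω[L⁄ℤ] :=
  .mk hz.linearIndependent_dlog hz.span_dlog.ge

theorem IsPBasis.dlogBasis_apply (i : ι) : hz.dlogBasis i = (z i)⁻¹ • D ℤ L (z i) := by
  simp [dlogBasis]

include hz in
theorem IsPBasis.card_eq_finrank : Fintype.card ι = Module.finrank L Ω[L⁄ℤ] :=
  (Module.finrank_eq_card_basis hz.dlogBasis).symm

end

/-- The form `du₁ ∧ ⋯ ∧ duₙ`. -/
def dform (u : Fin (Module.finrank L Ω[L⁄ℤ]) → L) : TopForm L :=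
  exteriorPower.ιMulti L _ fun i => D ℤ L (u i)

theorem ιMulti_eq_det_smul {M : Type*} [AddCommGroup M] [Module L M] {n : ℕ}
    (b : Module.Basis (Fin n) L M) (v : Fin n → M) :
    exteriorPower.ιMulti L n v = b.det v • exteriorPower.ιMulti L n b := by
  have : exteriorPower.ιMulti L n =
      (LinearMap.toSpanSingleton L _ (exteriorPower.ιMulti L n b)).compAlternatingMap b.det := by
    refine Module.Basis.ext_alternating b fun i hi => ?_
    obtain ⟨σ, rfl⟩ : ∃ σ : Equiv.Perm (Fin n), i = σ :=
      ⟨Equiv.ofBijective i (Finite.injective_iff_bijective.mp hi), rfl⟩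
    have h1 := (exteriorPower.ιMulti L n).map_perm b σ
    have h2 := b.det.map_perm b σ
    simp only [Function.comp_def] at h1 h2
    simp [h1, h2, b.det_self]
  exact DFunLike.congr_fun this v

theorem ιMulti_sum_smul {M : Type*} [AddCommGroup M] [Module L M] {n : ℕ}
    (b : Module.Basis (Fin n) L M) (a : Matrix (Fin n) (Fin n) L) :
    exteriorPower.ιMulti L n (fun i => ∑ j, a i j • b j) =
      a.det • exteriorPower.ιMulti L n b := by
  rw [ιMulti_eq_det_smul b, b.det_apply]
  congr 1
  rw [← Matrix.det_transpose]
  congr 1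
  ext i j
  simp [Module.Basis.toMatrix_apply, Finsupp.single_apply]

/-- A basis identifies the top exterior power with the field. -/
def volEquiv {M : Type*} [AddCommGroup M] [Module L M] {n : ℕ}
    (b : Module.Basis (Fin n) L M) : (⋀[L]^n M) ≃ₗ[L] L :=
  LinearEquiv.ofLinearMap (exteriorPower.alternatingMapLinearEquiv b.det)
    (LinearMap.toSpanSingleton L _ (exteriorPower.ιMulti L n b))
    (by ext; simp [b.det_self])
    (by
      refine exteriorPower.linearMap_ext ?_
      ext1 v
      simpa using (ιMulti_eq_det_smul b v).symm)

@[simp] theorem volEquiv_symm_apply {M : Type*} [AddCommGroup M] [Module L M] {n : ℕ}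
    (b : Module.Basis (Fin n) L M) (x : L) :
    (volEquiv b).symm x = x • exteriorPower.ιMulti L n b := rfl

theorem volEquiv_smul_ιMulti {M : Type*} [AddCommGroup M] [Module L M] {n : ℕ}
    (b : Module.Basis (Fin n) L M) (x : L) :
    volEquiv b (x • exteriorPower.ιMulti L n b) = x := by
  rw [← volEquiv_symm_apply, LinearEquiv.apply_symm_apply]

theorem exists_smul_eq {M : Type*} [AddCommGroup M] [Module L M] {n : ℕ}
    (b : Module.Basis (Fin n) L M) (ω : ⋀[L]^n M) : ∃ x : L, ω = x • exteriorPower.ιMulti L n b :=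
  ⟨volEquiv b ω, ((volEquiv b).symm_apply_apply ω).symm⟩

theorem dform_update (u : Fin (Module.finrank L Ω[L⁄ℤ]) → L) (i) (x : L) :
    dform (Function.update u i x) =
      exteriorPower.ιMulti L _ (Function.update (fun j => D ℤ L (u j)) i (D ℤ L x)) := by
  rw [dform]
  congr 1
  exact Function.comp_update (D ℤ L) u i x

theorem ιMulti_update_eq_zero {M : Type*} [AddCommGroup M] [Module L M] {n : ℕ}
    (v : Fin n → M) (i : Fin n) {w : M} (hw : w ∈ Submodule.span L (v '' {i}ᶜ)) :
    exteriorPower.ιMulti L n (Function.update v i w) = 0 := by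
  induction hw using Submodule.span_induction with
  | mem w hw =>
    obtain ⟨j, hj, rfl⟩ := hw
    exact AlternatingMap.map_update_self _ _ (Ne.symm hj)
  | zero => exact AlternatingMap.map_update_zero _ _ _
  | add x y _ _ hx hy => rw [AlternatingMap.map_update_add, hx, hy, add_zero]
  | smul a x _ hx => rw [AlternatingMap.map_update_smul, hx, smul_zero]

theorem D_prod_mem_span {ι : Type*} [DecidableEq ι] (u : ι → L) (s : Finset ι) :
    D ℤ L (∏ i ∈ s, u i) ∈ Submodule.span L ((fun i => D ℤ L (u i)) '' s) := by
  induction s using Finset.induction_on with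
  | empty => simp
  | insert a s ha ih =>
    rw [Finset.prod_insert ha, Derivation.leibniz]
    refine add_mem (Submodule.smul_mem _ _ ?_) (Submodule.smul_mem _ _ ?_)
    · exact Submodule.span_mono (Set.image_mono (by simp)) ih
    · exact Submodule.subset_span ⟨a, by simp, rfl⟩

/-- `x ^ (p - 1) dx` is additive in `x` up to exact forms. -/
theorem exists_pow_smul_D_add (p : ℕ) [Fact p.Prime] [CharP L p] (x y : L) :
    ∃ Q : L, (x + y) ^ (p - 1) • D ℤ L (x + y) =
      x ^ (p - 1) • D ℤ L x + y ^ (p - 1) • D ℤ L y + D ℤ L Q := by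
  obtain ⟨N, hN⟩ : ∃ N, p = N + 1 := Nat.exists_eq_succ_of_ne_zero (Fact.out : p.Prime).ne_zero
  have hunit : ∀ k < N, ((k + 1 : ℕ) : L) ≠ 0 := fun k hk h => by
    rw [CharP.cast_eq_zero_iff L p] at h
    exact absurd (Nat.le_of_dvd (by omega) h) (by omega)
  -- This is `((x + y) ^ p - x ^ p - y ^ p) / p`, because `choose p (k + 1) / p = choose (p - 1) k /
  -- (k + 1)`; the denominators are less than `p`, hence invertible.
  refine ⟨∑ k ∈ Finset.range N,
    ((N.choose k : L) / ((k + 1 : ℕ) : L)) * (x ^ (k + 1) * y ^ (N - k)), ?_⟩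
  have hc : ∀ (m k : ℕ), D ℤ L ((m : L) / (k : L)) = 0 := fun m k => by
    simp [div_eq_mul_inv, Derivation.leibniz, Derivation.leibniz_inv]
  have hterm : ∀ k ∈ Finset.range N, D ℤ L (((N.choose k : L) / ((k + 1 : ℕ) : L)) *
      (x ^ (k + 1) * y ^ (N - k))) = (x ^ k * y ^ (N - k) * (N.choose k : L)) • D ℤ L x +
        (x ^ (k + 1) * y ^ (N - (k + 1)) * (N.choose (k + 1) : L)) • D ℤ L y := by
    intro k hk
    have hk' := Finset.mem_range.mp hk
    have h0 := hunit k hk'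
    have hch : (N.choose (k + 1) : L) * ((k + 1 : ℕ) : L) = N.choose k * ((N - k : ℕ) : L) := by
      exact_mod_cast congrArg (Nat.cast : ℕ → L) (Nat.choose_succ_right_eq N k)
    rw [Derivation.leibniz, hc, smul_zero, add_zero, Derivation.leibniz, Derivation.leibniz_pow,
      Derivation.leibniz_pow, ← Nat.cast_smul_eq_nsmul L, ← Nat.cast_smul_eq_nsmul L, smul_add,
      add_comm]
    simp only [smul_smul, Nat.add_sub_cancel]
    congr 2
    · field_simp
    · rw [Nat.sub_sub]
      field_simp
      linear_combination (-(x * x ^ k) * y ^ (N - (k + 1))) * hch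
  rw [map_sum, Finset.sum_congr rfl hterm, Finset.sum_add_distrib, ← Finset.sum_smul,
    ← Finset.sum_smul, hN, Nat.add_sub_cancel, map_add, smul_add]
  -- The same power is expanded twice: `x ^ N` is split off in the coefficient of `dx`, `y ^ N` in
  -- that of `dy`.
  have e1 : (x + y) ^ N = ∑ k ∈ Finset.range N, x ^ k * y ^ (N - k) * (N.choose k : L) + x ^ N := by
    rw [add_pow, Finset.sum_range_succ]; simp
  have e2 : (x + y) ^ N =
      ∑ k ∈ Finset.range N, x ^ (k + 1) * y ^ (N - (k + 1)) * (N.choose (k + 1) : L) + y ^ N := by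
    rw [add_pow, Finset.sum_range_succ']; simp
  nth_rewrite 1 [e1]
  rw [e2, add_smul, add_smul]
  abel

/-- The characteristic properties of the Cartier operator on top forms. -/
structure IsCartierOperator (p : ℕ) (C : TopForm L →+ TopForm L) : Prop where
  map_pow_smul : ∀ (a : L) (ω : TopForm L), C (a ^ p • ω) = a • C ω
  -- The dummy index restricts this to positive degree: in degree zero the empty wedge is not an
  -- exact form.
  map_dform : ∀ (_ : Fin (Module.finrank L Ω[L⁄ℤ])) (u), C (dform u) = 0
  map_dlog : ∀ u, C ((∏ i, u i) ^ (p - 1) • dform u) = dform u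

/-- Each factor is `c ^ p * z ^ m` times a combination of the `dlog z j` with the exponents as
coefficients. The determinant is kept as an integer because integers are fixed by Frobenius. -/
theorem dform_pow_mul_mono {z : Fin (Module.finrank L Ω[L⁄ℤ]) → L} (hz : IsPBasis p z)
    (c : Fin (Module.finrank L Ω[L⁄ℤ]) → L) (m : Fin (Module.finrank L Ω[L⁄ℤ]) →
      Fin (Module.finrank L Ω[L⁄ℤ]) → ℕ) :
    dform (fun i => c i ^ p * mono z (m i)) =
      ((∏ i, c i ^ p * mono z (m i)) * (((Matrix.of fun i j => (m i j : ℤ)).det : ℤ) : L)) •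
        exteriorPower.ιMulti L _ hz.dlogBasis := by
  have h : ∀ i, D ℤ L (c i ^ p * mono z (m i)) =
      (c i ^ p * mono z (m i)) • ∑ j, (m i j : L) • hz.dlogBasis j := fun i => by
    rw [D_pow_char_mul, D_mono hz.ne_zero, smul_smul]
    simp only [hz.dlogBasis_apply]
  rw [dform]
  simp only [h]
  have h1 := (exteriorPower.ιMulti L (Module.finrank L Ω[L⁄ℤ])).toMultilinearMap.map_smul_univ
    (fun i => c i ^ p * mono z (m i)) (fun i => ∑ j, (m i j : L) • hz.dlogBasis j)
  simp only [AlternatingMap.coe_multilinearMap] at h1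
  have h2 := ιMulti_sum_smul hz.dlogBasis (Matrix.of fun i j => (m i j : L))
  simp only [Matrix.of_apply] at h2
  rw [h1, h2, smul_smul]
  congr 2
  rw [Int.cast_det]
  congr 1
  ext i j
  simp

/-- The Cartier operator defined by a `p`-basis. -/
def IsPBasis.cartier {z : Fin (Module.finrank L Ω[L⁄ℤ]) → L} (hz : IsPBasis p z) :
    TopForm L →+ TopForm L where
  -- Relative to `dlog z₁ ∧ ⋯ ∧ dlog zₙ`, the operator keeps only the component of exponent zero and
  -- takes its `p`-th root.
  toFun ω := hz.coeff (fun _ => ⟨0, (Fact.out : p.Prime).pos⟩) (volEquiv hz.dlogBasis ω) •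
    exteriorPower.ιMulti L _ hz.dlogBasis
  map_zero' := by simp [hz.coeff_zero]
  map_add' x y := by rw [map_add, hz.coeff_add, add_smul]

theorem IsPBasis.cartier_smul {z : Fin (Module.finrank L Ω[L⁄ℤ]) → L} (hz : IsPBasis p z) (x : L) :
    hz.cartier (x • exteriorPower.ιMulti L _ hz.dlogBasis) =
      hz.coeff (fun _ => ⟨0, (Fact.out : p.Prime).pos⟩) x •
        exteriorPower.ιMulti L _ hz.dlogBasis := by
  simp only [cartier, AddMonoidHom.coe_mk, ZeroHom.coe_mk]
  rw [volEquiv_smul_ιMulti]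

/-- Frees the operator from its coordinates: the three properties do not mention `z`, so the
operator may afterwards be studied through the `p`-basis of any other valuation ring of `L`. -/
theorem IsPBasis.isCartierOperator {z : Fin (Module.finrank L Ω[L⁄ℤ]) → L} (hz : IsPBasis p z) :
    IsCartierOperator p hz.cartier := by
  have hsemi : ∀ (a : L) (ω : TopForm L), hz.cartier (a ^ p • ω) = a • hz.cartier ω := by
    intro a ω
    obtain ⟨x, rfl⟩ := exists_smul_eq hz.dlogBasis ω
    rw [smul_smul, cartier_smul, cartier_smul, hz.coeff_pow_mul, mul_smul]
  have hgen : (0 : L) ∈ {x : L | ∃ (c : L) (m : Fin (Module.finrank L Ω[L⁄ℤ]) → ℕ),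
      x = c ^ p * mono z m} := ⟨0, 0, by simp [(Fact.out : p.Prime).ne_zero]⟩
  have hint : ∀ k : ℤ, (k : L) ^ p = k := fun k => map_intCast (frobenius L p) k
  have hexact : ∀ (_ : Fin (Module.finrank L Ω[L⁄ℤ])) (u), hz.cartier (dform u) = 0 := by
    intro i₀
    refine forall_of_update_add hz.closure_monomials hgen ?_ ?_
    · intro u i x y hx hy
      rw [dform_update] at hx hy ⊢
      rw [map_add, AlternatingMap.map_update_add, map_add, hx, hy, add_zero]
    · intro u hu
      choose c m hm using hu
      obtain rfl : u = fun i => c i ^ p * mono z (m i) := funext hm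
      rw [dform_pow_mul_mono hz, Finset.prod_mul_distrib, ← hint, Finset.prod_pow, ← mono_sum,
        mul_right_comm, ← mul_pow, cartier_smul, hz.coeff_pow_mul, hz.coeff_mono]
      split_ifs with h
      -- The exponent-zero component survives only if the rows of the exponent matrix sum to zero
      -- modulo `p`. The all-ones vector, nonzero thanks to `i₀`, then annihilates the matrix.
      · have hdet : (((Matrix.of fun i j => (m i j : ℤ)).det : ℤ) : L) = 0 := by
          rw [Int.cast_det]
          refine Matrix.exists_vecMul_eq_zero_iff.mp ⟨fun _ => 1, ?_, ?_⟩
          · exact fun h => one_ne_zero (congrFun h i₀)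
          · funext j
            have hj := congrFun h j
            simp only [Finset.sum_apply] at hj
            have : ((∑ i, m i j : ℕ) : L) = 0 := by
              rw [CharP.cast_eq_zero_iff L p]
              exact Nat.dvd_of_mod_eq_zero hj.symm
            simpa [Matrix.vecMul, dotProduct] using this
        rw [hdet]; simp
      · simp
  refine ⟨hsemi, hexact, ?_⟩
  refine forall_of_update_add hz.closure_monomials hgen ?_ ?_
  · intro u i x y hx hy
    have hprod : ∀ x : L, (∏ j, Function.update u i x j) =
        x * ∏ j ∈ Finset.univ.erase i, u j := by
      intro x
      rw [← Finset.mul_prod_erase _ _ (Finset.mem_univ i)]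
      simp only [Function.update_self]
      congr 1
      exact Finset.prod_congr rfl fun j hj => by simp [Finset.ne_of_mem_erase hj]
    rw [hprod, dform_update] at hx hy ⊢
    set A := ∏ j ∈ Finset.univ.erase i, u j
    -- The scalar is moved into slot `i`, where additivity of `x ^ (p - 1) dx` up to exact forms can
    -- be applied.
    have hA : ∀ x : L, (x * A) ^ (p - 1) • exteriorPower.ιMulti L (Module.finrank L Ω[L⁄ℤ])
        (Function.update (fun j => D ℤ L (u j)) i (D ℤ L x)) =
        exteriorPower.ιMulti L (Module.finrank L Ω[L⁄ℤ]) (Function.update (fun j => D ℤ L (u j)) i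
          (A ^ (p - 1) • x ^ (p - 1) • D ℤ L x)) := by
      intro x
      rw [AlternatingMap.map_update_smul, AlternatingMap.map_update_smul, smul_smul]
      congr 1
      ring
    rw [hA] at hx hy ⊢
    obtain ⟨Q, hQ⟩ := exists_pow_smul_D_add p x y
    -- `A ^ (p - 1) dQ` differs from the exact `d(A ^ (p - 1) Q)` by a combination of the other `du
    -- j`, which the wedge kills.
    have hQ0 : hz.cartier (exteriorPower.ιMulti L (Module.finrank L Ω[L⁄ℤ])
        (Function.update (fun j => D ℤ L (u j)) i (A ^ (p - 1) • D ℤ L Q))) = 0 := by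
      have h1 : A ^ (p - 1) • D ℤ L Q = D ℤ L (A ^ (p - 1) * Q) - Q • D ℤ L (A ^ (p - 1)) := by
        rw [Derivation.leibniz]; abel
      have h2 : Q • D ℤ L (A ^ (p - 1)) ∈
          Submodule.span L ((fun j => D ℤ L (u j)) '' {i}ᶜ) := by
        rw [Derivation.leibniz_pow, ← Nat.cast_smul_eq_nsmul L]
        refine Submodule.smul_mem _ _ (Submodule.smul_mem _ _ (Submodule.smul_mem _ _ ?_))
        refine Submodule.span_mono (Set.image_mono ?_) (D_prod_mem_span u _)
        intro j hj
        simpa using hj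
      rw [h1, sub_eq_add_neg, AlternatingMap.map_update_add, ← dform_update,
        ιMulti_update_eq_zero _ _ (neg_mem h2), add_zero, hexact i]
    rw [hQ, smul_add, smul_add, AlternatingMap.map_update_add, AlternatingMap.map_update_add,
      map_add, map_add, hx, hy, hQ0, add_zero, map_add (D ℤ L), AlternatingMap.map_update_add]
  · intro u hu
    choose c m hm using hu
    obtain rfl : u = fun i => c i ^ p * mono z (m i) := funext hm
    have h1 : hz.coeff (fun _ => ⟨0, (Fact.out : p.Prime).pos⟩) (1 : L) = 1 := by
      have := hz.coeff_mono (fun _ => ⟨0, (Fact.out : p.Prime).pos⟩) 0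
      rw [mono_zero, if_pos (by funext i; simp)] at this
      rw [this]
      convert mono_zero z using 2
      funext i
      simp
    -- The scalar becomes the full `p`-th power of the product of the entries, and the determinant
    -- is its own `p`-th power, so the operator extracts an exact `p`-th root.
    rw [dform_pow_mul_mono hz, smul_smul, ← mul_assoc, pow_sub_one_mul (Fact.out : p.Prime).ne_zero]
    nth_rewrite 1 [← hint]
    rw [← mul_pow, ← mul_one ((_ * _ : L) ^ p), cartier_smul, hz.coeff_pow_mul, h1, mul_one]

end Differentials


/-! ### Existence of p-bases -/

section Existence

/-- Here `K ^ p ⊆ F`. For `y` outside `F` the polynomial `X ^ p - y ^ p` is irreducible over `F`, so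
`1, y, …, y ^ (p - 1)` is a basis of `F(y)`. Induction on the degree applies to `K` over `F(y)`, and
bases multiply in the tower. -/
theorem exists_basis_mono (p : ℕ) [Fact p.Prime] {K : Type u} [Field K] [CharP K p] (d : ℕ) :
    ∀ (F : Type u) [Field F] [Algebra F K] [FiniteDimensional F K],
      (∀ x : K, ∃ a : F, algebraMap F K a = x ^ p) → Module.finrank F K = d →
      ∃ (n : ℕ) (z : Fin n → K) (b : Module.Basis (Fin n → Fin p) F K),
        ∀ α, b α = mono z fun i => (α i : ℕ) := by
  have hp := (Fact.out : p.Prime)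
  induction d using Nat.strong_induction_on with
  | _ d ih =>
  intro F _ _ _ hF hd
  by_cases hsurj : Function.Surjective (algebraMap F K)
  · refine ⟨0, Fin.elim0, (Module.Basis.singleton (Fin 0 → Fin p) F).map
      (LinearEquiv.ofBijective (Algebra.linearMap F K) ⟨(algebraMap F K).injective, hsurj⟩),
      fun α => ?_⟩
    simp only [mono, Finset.univ_eq_empty, Finset.prod_empty, Module.Basis.map_apply,
      Module.Basis.singleton_apply]
    exact map_one (algebraMap F K)
  · obtain ⟨y, hy⟩ := not_forall.mp hsurj
    obtain ⟨a, ha⟩ := hF y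
    have hirr : Irreducible (Polynomial.X ^ p - Polynomial.C a : Polynomial F) := by
      refine X_pow_sub_C_irreducible_of_prime hp fun b hb => hy ⟨b, ?_⟩
      apply frobenius_inj K p
      rw [frobenius_def, frobenius_def, ← map_pow, hb, ha]
    have hmin : minpoly F y = Polynomial.X ^ p - Polynomial.C a :=
      (minpoly.eq_of_irreducible_of_monic hirr (by simp [ha])
        (Polynomial.monic_X_pow_sub_C a hp.ne_zero)).symm
    have hint : IsIntegral F y := Algebra.IsIntegral.isIntegral y
    let F' := IntermediateField.adjoin F {y}
    let pb := IntermediateField.adjoin.powerBasis hint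
    have hdim : pb.dim = p := by
      rw [IntermediateField.adjoin.powerBasis_dim, hmin, Polynomial.natDegree_X_pow_sub_C]
    have hrank : Module.finrank F F' = p := by rw [← hdim]; exact pb.finrank
    have hmul := Module.finrank_mul_finrank F F' K
    have hpos : 0 < Module.finrank F' K := Module.finrank_pos
    have hlt : Module.finrank F' K < d := by
      rw [← hd, ← hmul, hrank]
      exact lt_mul_of_one_lt_left hpos hp.one_lt
    obtain ⟨n, z, b, hb⟩ := ih _ hlt F' (fun x => by
      obtain ⟨c, hc⟩ := hF x
      exact ⟨algebraMap F F' c, by rw [← hc]; rfl⟩) rfl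
    refine ⟨n + 1, Fin.cons y z,
      ((pb.basis.reindex (finCongr hdim)).smulTower b).reindex (Fin.consEquiv fun _ => Fin p),
      fun α => ?_⟩
    simp only [Module.Basis.reindex_apply, Module.Basis.smulTower_apply, hb, Fin.consEquiv,
      Equiv.symm, PowerBasis.coe_basis, mono, Fin.prod_univ_succ]
    simp [pb, Algebra.smul_def]
    exact Or.inl rfl

/-- An F-finite field has a finite `p`-basis. -/
theorem exists_isPBasis_field (p : ℕ) [Fact p.Prime] (K : Type u) [Field K] [CharP K p]
    (h : (frobenius K p).Finite) : ∃ (n : ℕ) (z : Fin n → K), IsPBasis p z := by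
  let F := (frobenius K p).fieldRange
  have hfin : F.subtype.Finite := by
    refine RingHom.Finite.of_comp_finite (f := (frobenius K p).rangeRestrictField) ?_
    exact h
  have : FiniteDimensional F K := hfin
  obtain ⟨n, z, b, hb⟩ := exists_basis_mono p _ F
    (fun x => ⟨⟨x ^ p, x, rfl⟩, rfl⟩) rfl
  refine ⟨n, z, ?_⟩
  -- Frobenius identifies `K` with `K ^ p`, so coordinates over `K ^ p` are `p`-th powers of unique
  -- elements of `K`.
  let g : ((Fin n → Fin p) → K) → ((Fin n → Fin p) → F) := fun c α => ⟨c α ^ p, c α, rfl⟩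
  have hg : Function.Bijective g := by
    refine ⟨fun c c' hcc => funext fun α => ?_, fun c => ?_⟩
    · exact frobenius_inj K p (congrArg Subtype.val (congrFun hcc α))
    · choose d hd using fun α => (c α).2
      exact ⟨d, funext fun α => Subtype.ext (hd α)⟩
  have e : (fun c : (Fin n → Fin p) → K => ∑ α, c α ^ p * mono z fun i => (α i : ℕ)) =
      b.equivFun.symm ∘ g := by
    funext c
    simp [Module.Basis.equivFun_symm_apply, hb, g, Algebra.smul_def]
    rfl
  rw [IsPBasis, e]
  exact b.equivFun.symm.bijective.comp hg

theorem charP_residueField (p : ℕ) [Fact p.Prime] (S : Type*) [CommRing S] [IsLocalRing S]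
    [CharP S p] : CharP (IsLocalRing.ResidueField S) p := by
  rw [CharP.charP_iff_prime_eq_zero Fact.out, ← map_natCast (IsLocalRing.residue S),
    CharP.cast_eq_zero, map_zero]

/-- An F-finite discrete valuation ring has a finite `p`-basis, consisting of a uniformizer and
lifts of a `p`-basis of the residue field. -/
theorem exists_isPBasis_dvr (p : ℕ) [Fact p.Prime] (S : Type u) [CommRing S] [IsDomain S]
    [IsDiscreteValuationRing S] [CharP S p] (h : (frobenius S p).Finite) :
    ∃ (n : ℕ) (z : Fin (n + 1) → S), IsPBasis p z := by
  have hp := (Fact.out : p.Prime)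
  let κ := IsLocalRing.ResidueField S
  have : CharP κ p := charP_residueField p S
  let π : S →+* κ := IsLocalRing.residue S
  have hπ : Function.Surjective π := IsLocalRing.residue_surjective
  have hκ : (frobenius κ p).Finite := by
    refine RingHom.Finite.of_comp_finite (f := π) ?_
    have : (frobenius κ p).comp π = π.comp (frobenius S p) := by
      ext x; simp [frobenius_def]
    rw [this]
    exact (RingHom.Finite.of_surjective _ hπ).comp h
  obtain ⟨n, y, hy⟩ := exists_isPBasis_field p κ hκ
  choose w hw using fun i => hπ (y i)
  obtain ⟨t, ht⟩ := IsDiscreteValuationRing.exists_irreducible S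
  have hπt : ∀ x, π x = 0 ↔ t ∣ x := fun x => by
    rw [IsLocalRing.residue_eq_zero_iff, ht.maximalIdeal_eq, Ideal.mem_span_singleton]
  let B : ((Fin n → Fin p) → S) → S := fun c => ∑ α, c α ^ p * mono w fun i => (α i : ℕ)
  have hπB : ∀ c, π (B c) = ∑ α, π (c α) ^ p * mono y fun i => (α i : ℕ) := fun c => by
    simp only [B, map_sum, map_mul, map_pow, map_mono, hw]
  -- Uniqueness of expansions in the residue field.
  have hB0 : ∀ c, t ∣ B c → ∀ α, t ∣ c α := fun c hc α => by
    rw [← hπt, hπB] at hc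
    rw [← hπt]
    have := hy.coeff_eq hc α
    rw [← this, hy.coeff_zero]
  have hBs : ∀ x, ∃ c, t ∣ x - B c := fun x => by
    choose c hc using fun α => hπ (hy.coeff α (π x))
    refine ⟨c, (hπt _).mp ?_⟩
    rw [map_sub, hπB]
    simp only [hc, hy.sum_coeff, sub_self]
  have hsplit : ∀ c : (Fin (n + 1) → Fin p) → S,
      ∑ α, c α ^ p * mono (Fin.cons t w : Fin (n + 1) → S) (fun i => (α i : ℕ)) =
        ∑ i : Fin p, t ^ (i : ℕ) * B fun α => c (Fin.cons i α) := by
    intro c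
    rw [← (Fin.consEquiv fun _ => Fin p).sum_comp, Fintype.sum_prod_type]
    refine Finset.sum_congr rfl fun i _ => ?_
    rw [Finset.mul_sum]
    refine Finset.sum_congr rfl fun α _ => ?_
    simp [mono, Fin.prod_univ_succ, Fin.consEquiv]
    ring
  refine ⟨n, Fin.cons t w, ?_, ?_⟩
  · -- injectivity
    have hdvd : ∀ c : (Fin (n + 1) → Fin p) → S,
        ∑ i : Fin p, t ^ (i : ℕ) * B (fun α => c (Fin.cons i α)) = 0 → ∀ α, t ∣ c α := by
      intro c hc
      suffices H : ∀ k (hk : k < p) (α : Fin n → Fin p), t ∣ c (Fin.cons ⟨k, hk⟩ α) by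
        intro α
        have := H (α 0) (α 0).2 (Fin.tail α)
        rwa [Fin.eta, Fin.cons_self_tail] at this
      intro k
      induction k using Nat.strong_induction_on with
      | _ k ih =>
      intro hk
      refine hB0 _ ?_
      -- In the relation, terms before the `k`-th have coefficients divisible by `t`, which
      -- contribute `t ^ p`; terms after it carry `t ^ (k + 1)` explicitly.
      have h1 : t ^ (k + 1) ∣ t ^ k * B (fun α => c (Fin.cons ⟨k, hk⟩ α)) := by
        rw [← Finset.add_sum_erase _ _ (Finset.mem_univ (⟨k, hk⟩ : Fin p)),
          add_eq_zero_iff_eq_neg] at hc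
        rw [hc, dvd_neg]
        refine Finset.dvd_sum fun i hi => ?_
        rcases lt_trichotomy (i : ℕ) k with hik | hik | hik
        · refine Dvd.dvd.mul_left (Finset.dvd_sum fun α _ => Dvd.dvd.mul_right ?_ _) _
          exact (pow_dvd_pow t (by omega)).trans (pow_dvd_pow_of_dvd (ih i hik i.2 α) p)
        · exact absurd (Fin.ext hik) (Finset.ne_of_mem_erase hi)
        · exact Dvd.dvd.mul_right (pow_dvd_pow t hik) _
      rw [pow_succ] at h1
      exact (mul_dvd_mul_iff_left (pow_ne_zero k ht.ne_zero)).mp h1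
    -- A relation divided by `t ^ p` is again a relation, so its coefficients are divisible by every
    -- power of `t`; Krull's intersection theorem then makes them zero.
    have hpow : ∀ (k : ℕ) (c : (Fin (n + 1) → Fin p) → S),
        ∑ i : Fin p, t ^ (i : ℕ) * B (fun α => c (Fin.cons i α)) = 0 → ∀ α, t ^ k ∣ c α := by
      intro k
      induction k with
      | zero => simp
      | succ k ih =>
        intro c hc
        choose c' hc' using hdvd c hc
        have : ∑ i : Fin p, t ^ (i : ℕ) * B (fun α => c' (Fin.cons i α)) = 0 := by
          refine (mul_eq_zero.mp ?_).resolve_left (pow_ne_zero p ht.ne_zero)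
          rw [← hc, Finset.mul_sum]
          refine Finset.sum_congr rfl fun i _ => ?_
          simp only [B, hc', Finset.mul_sum]
          refine Finset.sum_congr rfl fun α _ => ?_
          ring
        intro α
        rw [hc', pow_succ']
        exact mul_dvd_mul_left t (ih c' this α)
    intro c c' hcc
    funext α
    have h0 : ∑ i : Fin p, t ^ (i : ℕ) * B (fun α => (c - c') (Fin.cons i α)) = 0 := by
      rw [← hsplit]
      simp only [Pi.sub_apply, sub_pow_char, sub_mul, Finset.sum_sub_distrib]
      exact sub_eq_zero.mpr hcc
    have h1 : c α - c' α ∈ (⨅ k : ℕ, IsLocalRing.maximalIdeal S ^ k) := by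
      rw [Ideal.mem_iInf]
      intro k
      rw [ht.maximalIdeal_eq, Ideal.span_singleton_pow, Ideal.mem_span_singleton]
      exact hpow k _ h0 α
    rw [Ideal.iInf_pow_eq_bot_of_isLocalRing _ (IsLocalRing.maximalIdeal.isMaximal S).ne_top] at h1
    exact sub_eq_zero.mp h1
  · -- surjectivity
    -- The image is a submodule when `S` acts through Frobenius. F-finiteness makes the ambient
    -- module finite, so Nakayama's lemma is available.
    let N : Submodule S (Root p 1 S) :=
      { carrier := {x | ∃ c : (Fin (n + 1) → Fin p) → S,
          ∑ i : Fin p, t ^ (i : ℕ) * B (fun α => c (Fin.cons i α)) = x}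
        zero_mem' := ⟨0, by simp [B, hp.ne_zero]; rfl⟩
        add_mem' := by
          rintro _ _ ⟨c, rfl⟩ ⟨c', rfl⟩
          refine ⟨c + c', ?_⟩
          simp only [B, Pi.add_apply, add_pow_char, add_mul, Finset.sum_add_distrib, mul_add]
          rfl
        smul_mem' := by
          rintro a _ ⟨c, rfl⟩
          refine ⟨fun α => a * c α, ?_⟩
          change _ = a ^ p ^ 1 * _
          simp only [B, mul_pow, mul_assoc, ← Finset.mul_sum, pow_one, mul_left_comm _ (a ^ p)] }
    have hfin : Module.Finite S (Root p 1 S) := by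
      have : (iterateFrobenius S p 1).Finite := by rwa [iterateFrobenius_one]
      exact this
    -- Successive approximation in powers of `t`. At `k = p` the error `t ^ p * r` is `t` acting on
    -- `r` in `Root p 1 S`, hence lies in the maximal ideal times the module.
    have key : ∀ k ≤ p, ∀ x : S, ∃ (c : (Fin (n + 1) → Fin p) → S) (r : S),
        x = ∑ i : Fin p, (if (i : ℕ) < k then t ^ (i : ℕ) * B (fun α => c (Fin.cons i α)) else 0) +
          t ^ k * r := by
      intro k
      induction k with
      | zero => exact fun _ x => ⟨0, x, by simp⟩
      | succ k ih =>
        intro hk x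
        obtain ⟨c, r, hx⟩ := ih (by omega) x
        obtain ⟨c', r', hr⟩ := hBs r
        refine ⟨fun α => if (α 0 : ℕ) < k then c α else c' (Fin.tail α), r', ?_⟩
        rw [hx, sub_eq_iff_eq_add.mp hr]
        rw [← Finset.add_sum_erase _ _ (Finset.mem_univ (⟨k, hk⟩ : Fin p)),
          ← Finset.add_sum_erase (a := (⟨k, hk⟩ : Fin p)) _ _ (Finset.mem_univ _)]
        have : ∀ i ∈ Finset.univ.erase (⟨k, hk⟩ : Fin p),
            (if (i : ℕ) < k then t ^ (i : ℕ) * B (fun α => c (Fin.cons i α)) else 0) =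
            if (i : ℕ) < k + 1 then t ^ (i : ℕ) * B (fun α =>
              if ((Fin.cons i α : Fin (n + 1) → Fin p) 0 : ℕ) < k then c (Fin.cons i α)
              else c' (Fin.tail (Fin.cons i α : Fin (n + 1) → Fin p))) else 0 := by
          intro i hi
          have hi' : (i : ℕ) ≠ k := fun h => Finset.ne_of_mem_erase hi (Fin.ext h)
          by_cases h : (i : ℕ) < k
          · simp [h, Nat.lt_succ_of_lt h]
          · rw [if_neg h, if_neg (by omega)]
        rw [Finset.sum_congr rfl this]
        simp
        ring
    have hN : N = ⊤ := by
      refine top_le_iff.mp (Submodule.le_of_le_smul_of_le_jacobson_bot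
        (I := IsLocalRing.maximalIdeal S) hfin.fg_top
        (IsLocalRing.maximalIdeal_le_jacobson _) ?_)
      intro x _
      obtain ⟨c, r, hx⟩ := key p le_rfl x
      have h1 : root p 1 (∑ i : Fin p, t ^ (i : ℕ) * B (fun α => c (Fin.cons i α))) ∈ N := ⟨c, rfl⟩
      have h2 : root p 1 (t ^ p * r) ∈
          (IsLocalRing.maximalIdeal S) • (⊤ : Submodule S (Root p 1 S)) := by
        have : root p 1 (t ^ p * r) = t • root p 1 r := by
          change _ = t ^ p ^ 1 * r
          rw [pow_one]
          rfl
        rw [this]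
        exact Submodule.smul_mem_smul (by
          rw [ht.maximalIdeal_eq]; exact Ideal.mem_span_singleton_self t) trivial
      have h3 : x = root p 1 (∑ i : Fin p, t ^ (i : ℕ) * B (fun α => c (Fin.cons i α))) +
          root p 1 (t ^ p * r) := by
        refine Eq.trans hx ?_
        simp only [Fin.is_lt, if_true]
        rfl
      rw [h3]
      exact Submodule.add_mem_sup h1 h2
    intro x
    have hx : (x : Root p 1 S) ∈ N := hN ▸ trivial
    obtain ⟨c, hc⟩ := hx
    exact ⟨c, (hsplit c).trans hc⟩

/-- A `p`-basis of a domain is a `p`-basis of its fraction field. -/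
theorem IsPBasis.fractionRing {p : ℕ} [Fact p.Prime] {S L : Type*} [CommRing S] [IsDomain S]
    [Field L] [Algebra S L] [IsFractionRing S L] [CharP S p] [CharP L p] {ι : Type*} [Fintype ι]
    [DecidableEq ι] {z : ι → S} (hz : IsPBasis p z) :
    IsPBasis p fun i => algebraMap S L (z i) := by
  have hp := (Fact.out : p.Prime)
  have hmap : ∀ c : (ι → Fin p) → S, ∑ α, algebraMap S L (c α) ^ p *
      mono (fun i => algebraMap S L (z i)) (fun i => (α i : ℕ)) =
      algebraMap S L (∑ α, c α ^ p * mono z (fun i => (α i : ℕ))) := fun c => by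
    simp only [map_sum, map_mul, map_pow, map_mono]
  constructor
  · intro c c' hcc
    obtain ⟨b, hb⟩ := IsLocalization.exist_integer_multiples_of_finite (nonZeroDivisors S) (c - c')
    choose d hd using hb
    have hb0 : algebraMap S L b ≠ 0 := IsFractionRing.to_map_ne_zero_of_mem_nonZeroDivisors b.2
    have h0 : ∑ α, (c - c') α ^ p * mono (fun i => algebraMap S L (z i)) (fun i => (α i : ℕ)) = 0 := by
      simp only [Pi.sub_apply, sub_pow_char, sub_mul, Finset.sum_sub_distrib]
      exact sub_eq_zero.mpr hcc
    have h1 : ∑ α, d α ^ p * mono z (fun i => (α i : ℕ)) = 0 := by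
      apply IsFractionRing.injective S L
      rw [← hmap, map_zero]
      simp only [hd, Algebra.smul_def, mul_pow, mul_assoc, ← Finset.mul_sum, h0,
        mul_zero]
    funext α
    have h2 := hz.coeff_eq h1 α
    rw [hz.coeff_zero] at h2
    have h3 := hd α
    rw [← h2, map_zero, Algebra.smul_def, eq_comm] at h3
    exact sub_eq_zero.mp ((mul_eq_zero.mp h3).resolve_left hb0)
  · intro x
    obtain ⟨a, b, hb, rfl⟩ := IsFractionRing.div_surjective (A := S) x
    have hb0 : algebraMap S L b ≠ 0 := IsFractionRing.to_map_ne_zero_of_mem_nonZeroDivisors hb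
    -- From `a / b = a b ^ (p - 1) / b ^ p`: the denominator becomes a `p`-th power.
    refine ⟨fun α => algebraMap S L (hz.coeff α (a * b ^ (p - 1))) / algebraMap S L b, ?_⟩
    simp only [div_pow, div_mul_eq_mul_div]
    rw [← Finset.sum_div, hmap, hz.sum_coeff, map_mul, map_pow, div_eq_div_iff
      (pow_ne_zero _ hb0) hb0, mul_assoc, pow_sub_one_mul hp.ne_zero]

end Existence


/-! ### The Cartier operator and regular forms -/

section Regular

open KaehlerDifferential

variable {L : Type u} [Field L] {p : ℕ} [Fact p.Prime] [CharP L p]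

section

variable {z : Fin (Module.finrank L Ω[L⁄ℤ]) → L} (hz : IsPBasis p z)

/-- The differentials of a `p`-basis form a basis of the differentials. -/
def IsPBasis.dBasis : Module.Basis (Fin (Module.finrank L Ω[L⁄ℤ])) L Ω[L⁄ℤ] :=
  hz.dlogBasis.isUnitSMul fun i => (hz.ne_zero i).isUnit

theorem IsPBasis.dBasis_apply (i) : hz.dBasis i = D ℤ L (z i) := by
  rw [dBasis, Module.Basis.isUnitSMul_apply, hz.dlogBasis_apply, smul_inv_smul₀ (hz.ne_zero i)]

theorem IsPBasis.dform_eq : dform z = exteriorPower.ιMulti L _ hz.dBasis := by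
  rw [dform]
  congr 1
  funext i
  rw [hz.dBasis_apply]

include hz in
theorem IsPBasis.exists_smul_dform (ω : TopForm L) : ∃ x : L, ω = x • dform z := by
  rw [hz.dform_eq]
  exact exists_smul_eq hz.dBasis ω

include hz in
theorem IsPBasis.smul_dform_injective {x y : L} (h : x • dform z = y • dform z) : x = y := by
  rw [hz.dform_eq, ← volEquiv_symm_apply, ← volEquiv_symm_apply] at h
  exact (volEquiv hz.dBasis).symm.injective h

include hz in
theorem IsPBasis.dform_ne_zero : dform z ≠ 0 := fun h =>
  one_ne_zero (hz.smul_dform_injective (x := (1 : L)) (y := 0) (by rw [h, smul_zero, smul_zero]))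

variable {C : TopForm L →+ TopForm L} (hC : IsCartierOperator p C)

include hz hC

/-- Replacing `z i` by `z i * z ^ m` in slot `i` gives an exact form equal to `(m i + 1) z ^ m dz`,
since the other `dz j` drop out. The factor `m i + 1` is invertible and fixed by Frobenius. -/
theorem IsCartierOperator.map_mono_smul_dform_eq_zero {m : Fin (Module.finrank L Ω[L⁄ℤ]) → ℕ}
    {i : Fin (Module.finrank L Ω[L⁄ℤ])} (hm : ¬ p ∣ m i + 1) : C (mono z m • dform z) = 0 := by
  have hm0 : ((m i + 1 : ℕ) : L) ≠ 0 := fun h => hm ((CharP.cast_eq_zero_iff L p _).mp h)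
  set N : L := ((m i + 1 : ℕ) : L) with hN
  have hNp : (N⁻¹) ^ p = N⁻¹ := by
    rw [inv_pow]
    congr 1
    exact map_natCast (frobenius L p) _
  have h2 : D ℤ L (z i * mono z m) - (N * mono z m) • D ℤ L (z i) ∈
      Submodule.span L ((fun j => D ℤ L (z j)) '' {i}ᶜ) := by
    rw [Derivation.leibniz, D_mono hz.ne_zero, ← Finset.add_sum_erase _ _ (Finset.mem_univ i)]
    have : z i • mono z m • ((m i : L) • (z i)⁻¹ • D ℤ L (z i) +
        ∑ j ∈ Finset.univ.erase i, (m j : L) • (z j)⁻¹ • D ℤ L (z j)) + mono z m • D ℤ L (z i) -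
        (N * mono z m) • D ℤ L (z i) = (z i * mono z m) •
          ∑ j ∈ Finset.univ.erase i, (m j : L) • (z j)⁻¹ • D ℤ L (z j) := by
      rw [hN, smul_add, smul_add]
      have h3 : z i • mono z m • (m i : L) • (z i)⁻¹ • D ℤ L (z i) =
          (m i * mono z m : L) • D ℤ L (z i) := by
        simp only [smul_smul]
        congr 1
        field_simp [hz.ne_zero i]
      rw [h3, smul_smul (z i)]
      push_cast
      module
    rw [this]
    refine Submodule.smul_mem _ _ (sum_mem fun j hj => Submodule.smul_mem _ _
      (Submodule.smul_mem _ _ (Submodule.subset_span ⟨j, ?_, rfl⟩)))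
    simpa using hj
  have h4 : dform (Function.update z i (z i * mono z m)) = (N * mono z m) • dform z := by
    rw [dform_update, ← sub_add_cancel (D ℤ L (z i * mono z m)) ((N * mono z m) • D ℤ L (z i)),
      AlternatingMap.map_update_add, ιMulti_update_eq_zero _ _ h2, zero_add,
      AlternatingMap.map_update_smul, ← dform_update, Function.update_eq_self]
  have h5 : mono z m • dform z = (N⁻¹) ^ p • dform (Function.update z i (z i * mono z m)) := by
    rw [h4, hNp, smul_smul, inv_mul_cancel_left₀ hm0]
  rw [h5, hC.map_pow_smul, hC.map_dform i, smul_zero]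

/-- The monomials `z ^ α` and `z ^ (p - 1 - β)` are dual bases for the pairing `(h, g) ↦ C(h g dz)`:
if `α i ≠ β i`, the exponent plus one is `p + α i - β i`, not divisible by `p`. -/
theorem IsCartierOperator.map_mono_add_smul_dform (α β : Fin (Module.finrank L Ω[L⁄ℤ]) → Fin p) :
    C (mono z (fun i => (α i : ℕ) + (p - 1 - (β i : ℕ))) • dform z) =
      if α = β then dform z else 0 := by
  split_ifs with h
  · subst h
    have : (fun i => (α i : ℕ) + (p - 1 - (α i : ℕ))) = fun _ => p - 1 := by
      funext i
      have := (α i).2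
      omega
    rw [this, mono, Finset.prod_pow, hC.map_dlog]
  · obtain ⟨i, hi⟩ := Function.ne_iff.mp h
    refine hC.map_mono_smul_dform_eq_zero hz (i := i) ?_
    rintro ⟨k, hk⟩
    have h1 := (α i).2
    have h2 := (β i).2
    have h3 : (α i : ℕ) ≠ β i := fun h => hi (Fin.ext h)
    have hk1 : k = 1 := by
      refine le_antisymm (Nat.le_of_lt_succ ?_) (Nat.pos_of_ne_zero ?_)
      · by_contra hcon
        have : p * 2 ≤ p * k := Nat.mul_le_mul_left p (by omega)
        omega
      · rintro rfl; omega
    subst hk1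
    omega

/-- A coefficient of a form with respect to a `p`-basis, computed by the Cartier operator. -/
theorem IsCartierOperator.map_mono_mul_smul_dform (β : Fin (Module.finrank L Ω[L⁄ℤ]) → Fin p)
    (c : (Fin (Module.finrank L Ω[L⁄ℤ]) → Fin p) → L) :
    C ((mono z (fun i => p - 1 - (β i : ℕ)) * ∑ α, c α ^ p * mono z fun i => (α i : ℕ)) •
      dform z) = c β • dform z := by
  have : ∀ α : Fin (Module.finrank L Ω[L⁄ℤ]) → Fin p,
      (mono z (fun i => p - 1 - (β i : ℕ)) * (c α ^ p * mono z fun i => (α i : ℕ))) • dform z =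
        c α ^ p • mono z (fun i => (α i : ℕ) + (p - 1 - (β i : ℕ))) • dform z := fun α => by
    rw [mul_left_comm, mul_comm (mono z _), mul_smul, ← mono_add]
    rfl
  rw [Finset.mul_sum, Finset.sum_smul, map_sum]
  simp only [this, hC.map_pow_smul, hC.map_mono_add_smul_dform hz]
  rw [Finset.sum_eq_single β] <;> simp +contextual

end

section

variable {S : Subring L} {z : Fin (Module.finrank L Ω[L⁄ℤ]) → S} (hz : IsPBasis p z)
  (hzL : IsPBasis p fun i => (z i : L))

-- Every `ds` with `s` in `S` is an `S`-combination of the `dz j`, so a wedge of such differentials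
-- is a determinant over `S` times `dz`.
include hz hzL in
theorem IsPBasis.mem_regularForms_iff {ω : TopForm L} :
    ω ∈ regularForms S ↔ ∃ g : S, ω = (g : L) • dform fun i => (z i : L) := by
  constructor
  swap
  · rintro ⟨g, rfl⟩
    exact Submodule.smul_mem (regularForms S) g (Submodule.subset_span ⟨z, rfl⟩)
  intro hω
  let N : Submodule S Ω[L⁄ℤ] := Submodule.span S (Set.range fun i => D ℤ L (z i : L))
  have hmul : ∀ x y : S, D ℤ L (x : L) ∈ N → D ℤ L (y : L) ∈ N → D ℤ L (x * y : L) ∈ N := by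
    intro x y hx hy
    rw [Derivation.leibniz]
    exact add_mem (N.smul_mem x hy) (N.smul_mem y hx)
  have hpow : ∀ (x : S) (k : ℕ), D ℤ L (x : L) ∈ N → D ℤ L ((x : L) ^ k) ∈ N := by
    intro x k hx
    induction k with
    | zero => simp
    | succ k ih => rw [pow_succ]; exact hmul (x ^ k) x (by simpa using ih) hx
  have hmono : ∀ m : Fin (Module.finrank L Ω[L⁄ℤ]) → ℕ,
      D ℤ L (mono (fun i => (z i : L)) m) ∈ N := by
    intro m
    rw [mono]
    induction (Finset.univ : Finset (Fin (Module.finrank L Ω[L⁄ℤ]))) using Finset.induction_on with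
    | empty => simp
    | insert a s ha ih =>
      rw [Finset.prod_insert ha]
      have := hmul (z a ^ m a) (∏ i ∈ s, z i ^ m i)
        (by simpa using hpow (z a) (m a) (Submodule.subset_span ⟨a, rfl⟩)) (by simpa using ih)
      simpa using this
  have hD : ∀ s : S, ∃ a : Fin (Module.finrank L Ω[L⁄ℤ]) → S,
      D ℤ L (s : L) = ∑ j, (a j : L) • D ℤ L (z j : L) := by
    intro s
    have hs : D ℤ L (s : L) ∈ N := by
      rw [← hz.sum_coeff s]
      simp only [AddSubmonoidClass.coe_finsetSum, Subring.coe_mul, Subring.coe_pow, map_sum]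
      refine sum_mem fun α _ => ?_
      rw [D_pow_char_mul]
      have h1 : ((mono z fun i => (α i : ℕ) : S) : L) = mono (fun i => (z i : L)) fun i => (α i : ℕ) :=
        map_mono S.subtype z _
      rw [h1]
      exact N.smul_mem (hz.coeff α s ^ p) (hmono _)
    obtain ⟨a, ha⟩ := (Submodule.mem_span_range_iff_exists_fun S).mp hs
    exact ⟨a, ha.symm⟩
  induction hω using Submodule.span_induction with
  | mem ω hω =>
    obtain ⟨s, rfl⟩ := hω
    choose a ha using hD
    have h1 := ιMulti_sum_smul hzL.dBasis (Matrix.of fun i j => (a (s i) j : L))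
    simp only [Matrix.of_apply, hzL.dBasis_apply, ← ha, ← hzL.dform_eq] at h1
    refine ⟨(Matrix.of fun i j => a (s i) j).det, h1.trans ?_⟩
    congr 1
    rw [← Subring.subtype_apply, RingHom.map_det]
    rfl
  | zero => exact ⟨0, by simp⟩
  | add x y _ _ hx hy =>
    obtain ⟨g, rfl⟩ := hx
    obtain ⟨h, rfl⟩ := hy
    exact ⟨g + h, by rw [← add_smul]; rfl⟩
  | smul c x _ hx =>
    obtain ⟨g, rfl⟩ := hx
    exact ⟨c * g, by rw [Subring.coe_mul, mul_smul]; rfl⟩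

variable {C : TopForm L →+ TopForm L} (hC : IsCartierOperator p C)

include hz hzL hC

/-- `C(g dz)` is `dz` times the coefficient of `g` at the top exponent `(p - 1, …, p - 1)`, and this
lies in `S`. -/
theorem IsCartierOperator.map_mem_regularForms {ω : TopForm L} (hω : ω ∈ regularForms S) :
    C ω ∈ regularForms S := by
  rw [hz.mem_regularForms_iff hzL] at hω ⊢
  obtain ⟨g, rfl⟩ := hω
  rcases isEmpty_or_nonempty (Fin (Module.finrank L Ω[L⁄ℤ]) → Fin p) with h | ⟨⟨β⟩⟩
  · rw [← hz.sum_coeff g]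
    exact ⟨0, by simp⟩
  let γ : Fin (Module.finrank L Ω[L⁄ℤ]) → Fin p :=
    fun _ => ⟨p - 1, by have := (Fact.out : p.Prime).pos; omega⟩
  refine ⟨hz.coeff γ g, ?_⟩
  have := hC.map_mono_mul_smul_dform hzL γ fun α => (hz.coeff α g : L)
  rw [← this]
  congr 2
  have h0 : mono (fun i => (z i : L)) (fun i => p - 1 - (γ i : ℕ)) = 1 := by simp [mono, γ]
  nth_rewrite 1 [h0, one_mul, ← hz.sum_coeff g]
  simp only [AddSubmonoidClass.coe_finsetSum, Subring.coe_mul, Subring.coe_pow]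
  refine Finset.sum_congr rfl fun α _ => ?_
  congr 1
  exact map_mono S.subtype z _

/-- Duality: multiplication by `z ^ (p - 1 - β)` before `C` reads off the coefficient at `β`, so all
coefficients lie in `S`. -/
theorem IsCartierOperator.mem_regularForms {ω : TopForm L}
    (hω : ∀ g : S, C ((g : L) • ω) ∈ regularForms S) : ω ∈ regularForms S := by
  obtain ⟨x, rfl⟩ := hzL.exists_smul_dform ω
  have hx : ∀ β, ∃ a : S, (a : L) = hzL.coeff β x := by
    intro β
    have h1 := hω (mono z fun i => p - 1 - (β i : ℕ))
    have h2 := hC.map_mono_mul_smul_dform hzL β fun α => hzL.coeff α x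
    rw [hzL.sum_coeff] at h2
    have h3 : ((mono z (fun i => p - 1 - (β i : ℕ)) : S) : L) =
        mono (fun i => (z i : L)) fun i => p - 1 - (β i : ℕ) := map_mono S.subtype z _
    rw [smul_smul, h3, h2, hz.mem_regularForms_iff hzL] at h1
    obtain ⟨g, hg⟩ := h1
    exact ⟨g, (hzL.smul_dform_injective hg).symm⟩
  choose a ha using hx
  rw [hz.mem_regularForms_iff hzL]
  refine ⟨∑ α, a α ^ p * mono z fun i => (α i : ℕ), ?_⟩
  congr 1
  rw [← hzL.sum_coeff x]
  simp only [AddSubmonoidClass.coe_finsetSum, Subring.coe_mul, Subring.coe_pow, ha]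
  refine Finset.sum_congr rfl fun α _ => ?_
  congr 1
  exact (map_mono S.subtype z _).symm

end

/-! ### Iterates of the Cartier operator on regular forms -/

section Iterate

variable {C : TopForm L →+ TopForm L} (hC : IsCartierOperator p C)

include hC

omit [Fact p.Prime] [CharP L p] in
theorem IsCartierOperator.iterate_map_pow_smul (e : ℕ) (a : L) (ω : TopForm L) :
    C^[e] (a ^ p ^ e • ω) = a • C^[e] ω := by
  induction e generalizing ω with
  | zero => simp
  | succ e ih =>
    rw [Function.iterate_succ_apply, Function.iterate_succ_apply, pow_succ, pow_mul,
      hC.map_pow_smul, ih]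

omit hC in
theorem exists_isPBasis_of_dvr (S : Subring L) [IsDiscreteValuationRing S] [IsFractionRing S L]
    [CharP S p] (h : (frobenius S p).Finite) :
    0 < Module.finrank L Ω[L⁄ℤ] ∧ ∃ z : Fin (Module.finrank L Ω[L⁄ℤ]) → S, IsPBasis p z ∧
      IsPBasis p fun i => (z i : L) := by
  obtain ⟨n, z, hz⟩ := exists_isPBasis_dvr p S h
  have hzL : IsPBasis p fun i => (z i : L) := hz.fractionRing
  have hn := hzL.card_eq_finrank
  rw [Fintype.card_fin] at hn
  rw [← hn]
  exact ⟨Nat.succ_pos n, z, hz, hzL⟩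

variable (S : Subring L) [IsDiscreteValuationRing S] [IsFractionRing S L] [CharP S p]
  (hS : (frobenius S p).Finite)

include hS

theorem IsCartierOperator.iterate_mem_regularForms (e : ℕ) {ω : TopForm L}
    (hω : ω ∈ regularForms S) : C^[e] ω ∈ regularForms S := by
  obtain ⟨-, z, hz, hzL⟩ := exists_isPBasis_of_dvr S hS
  induction e generalizing ω with
  | zero => exact hω
  | succ e ih => exact ih (hC.map_mem_regularForms hz hzL hω)

theorem IsCartierOperator.mem_regularForms_of_iterate (e : ℕ) {ω : TopForm L}
    (hω : ∀ g : S, C^[e] ((g : L) • ω) ∈ regularForms S) : ω ∈ regularForms S := by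
  obtain ⟨-, z, hz, hzL⟩ := exists_isPBasis_of_dvr S hS
  induction e generalizing ω with
  | zero => simpa using hω 1
  | succ e ih =>
    refine ih fun g => hC.mem_regularForms hz hzL fun a => ?_
    -- The factor `a ^ p ^ e` leaves the inner `e` iterates as `a`, so it tests the last application
    -- of `C` alone.
    have := hω (a ^ p ^ e * g)
    rwa [Subring.coe_mul, Subring.coe_pow, mul_smul, Function.iterate_succ_apply',
      hC.iterate_map_pow_smul] at this

end Iterate

/-! ### Inverse-Frobenius-linear maps as multiples of the Cartier operator -/

section Generation

variable {z : Fin (Module.finrank L Ω[L⁄ℤ]) → L} (hz : IsPBasis p z)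
  {C : TopForm L →+ TopForm L} (hC : IsCartierOperator p C) {η : TopForm L} (hη : η ≠ 0)

include hz hC

theorem IsCartierOperator.exists_map_mul_smul_dform (ψ : L →+ L)
    (hψ : ∀ a g, ψ (a ^ p * g) = a * ψ g) :
    ∃ h : L, ∀ g, C ((h * g) • dform z) = ψ g • dform z := by
  -- The expansion of the functional `ψ` in the dual basis `z ^ (p - 1 - α)`.
  refine ⟨∑ α : Fin (Module.finrank L Ω[L⁄ℤ]) → Fin p, ψ (mono z fun i => (α i : ℕ)) ^ p *
    mono z fun i => p - 1 - (α i : ℕ), fun g => ?_⟩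
  rw [Finset.sum_mul, Finset.sum_smul, map_sum]
  have : ∀ α : Fin (Module.finrank L Ω[L⁄ℤ]) → Fin p,
      C ((ψ (mono z fun i => (α i : ℕ)) ^ p * mono z (fun i => p - 1 - (α i : ℕ)) * g) • dform z) =
        (ψ (hz.coeff α g ^ p * mono z fun i => (α i : ℕ))) • dform z := by
    intro α
    rw [mul_assoc, mul_smul, hC.map_pow_smul]
    nth_rewrite 1 [← hz.sum_coeff g]
    rw [hC.map_mono_mul_smul_dform hz α, smul_smul, hψ, mul_comm]
  simp only [this]
  rw [← Finset.sum_smul, ← map_sum, hz.sum_coeff]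

include hη

/-- Every `p⁻¹`-linear map of the field to itself is given by the Cartier operator. -/
theorem IsCartierOperator.exists_map_mul_smul (ψ : L →+ L)
    (hψ : ∀ a g, ψ (a ^ p * g) = a * ψ g) : ∃ h : L, ∀ g, C ((h * g) • η) = ψ g • η := by
  obtain ⟨u, rfl⟩ := hz.exists_smul_dform η
  have hu : u ≠ 0 := fun h => hη (by rw [h, zero_smul])
  obtain ⟨h, hh⟩ := hC.exists_map_mul_smul_dform hz ((AddMonoidHom.mulLeft u).comp ψ)
    (fun a g => by
      simp only [AddMonoidHom.comp_apply, AddMonoidHom.coe_mulLeft, hψ]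
      ring)
  refine ⟨u⁻¹ * h, fun g => ?_⟩
  rw [smul_smul, smul_smul, mul_comm (ψ g)]
  simp only [AddMonoidHom.comp_apply, AddMonoidHom.coe_mulLeft] at hh
  rw [← hh]
  congr 2
  field_simp

/-- Nondegeneracy: if `θ ≠ 0`, some `g` makes the form equal to `(∏ z i) ^ (p - 1) dz`, whose image
is `dz ≠ 0`. -/
theorem IsCartierOperator.eq_zero_of_forall_map {θ : L} (h : ∀ g : L, C ((θ * g) • η) = 0) :
    θ = 0 := by
  by_contra hθ
  obtain ⟨u, rfl⟩ := hz.exists_smul_dform η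
  have hu : u ≠ 0 := fun h => hη (by rw [h, zero_smul])
  refine hz.dform_ne_zero ?_
  rw [← hC.map_dlog z, ← h (θ⁻¹ * u⁻¹ * (∏ i, z i) ^ (p - 1)), smul_smul]
  congr 2
  field_simp

/-- For fixed `g` the map `b ↦ ψ(b ^ p ^ e * g)` is `p⁻¹`-linear, hence represented by some `θ g`.
Uniqueness of the representative makes `θ` itself `p⁻ᵉ`-linear, so induction applies to `θ`. -/
theorem IsCartierOperator.exists_iterate_mul_smul (e : ℕ) (ψ : L →+ L)
    (hψ : ∀ a g, ψ (a ^ p ^ e * g) = a * ψ g) :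
    ∃ h : L, ∀ g, C^[e] ((h * g) • η) = ψ g • η := by
  induction e generalizing ψ with
  | zero =>
    refine ⟨ψ 1, fun g => ?_⟩
    have := hψ g 1
    rw [pow_zero, pow_one, mul_one] at this
    rw [this, mul_comm]
    rfl
  | succ e ih =>
    have h1 : ∀ g : L, ∃ θ : L, ∀ b, C ((θ * b) • η) = ψ (b ^ p ^ e * g) • η := fun g =>
      hC.exists_map_mul_smul hz hη
        { toFun := fun b => ψ (b ^ p ^ e * g)
          map_zero' := by simp [(Fact.out : p.Prime).ne_zero]
          map_add' := fun b b' => by rw [add_pow_char_pow, add_mul, map_add] }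
        (fun a b => by
          simp only [AddMonoidHom.coe_mk, ZeroHom.coe_mk]
          rw [mul_pow, ← pow_mul, ← pow_succ', mul_assoc, hψ])
    choose θ hθ using h1
    have huniq : ∀ x y : L, (∀ b, C ((x * b) • η) = C ((y * b) • η)) → x = y := fun x y h => by
      rw [← sub_eq_zero]
      refine hC.eq_zero_of_forall_map hz hη fun g => ?_
      rw [sub_mul]
      exact (congrArg C (sub_smul (x * g) (y * g) η)).trans (by rw [map_sub, h, sub_self])
    obtain ⟨h, hh⟩ := ih
      (AddMonoidHom.mk' θ fun g g' => huniq _ _ fun b => by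
        rw [add_mul, add_smul, map_add, hθ, hθ, hθ, mul_add, map_add, add_smul])
      (fun a g => huniq _ _ fun b => by
        have : a * θ g * b = θ g * (a * b) := by ring
        simp only [AddMonoidHom.mk'_apply]
        rw [this, hθ, hθ]
        congr 2
        ring)
    refine ⟨h, fun g => ?_⟩
    rw [Function.iterate_succ_apply', hh]
    have := hθ g 1
    rwa [mul_one, one_pow, one_mul] at this

end Generation

end Regular


/-! ### Commutative algebra -/

section CommutativeAlgebra

/-- Localization costs nothing: `t⁻¹ = t ^ (p - 1) * (t⁻¹) ^ p` and the last factor comes from `R`.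
So `S` is of finite type, and it is integral over `R`. -/
theorem finite_of_essFiniteType_of_pow {R S : Type*} [CommRing R] [CommRing S] (f : R →+* S)
    (hf : f.EssFiniteType) {p : ℕ} (hp : p ≠ 0) (h : ∀ s : S, s ^ p ∈ f.range) : f.Finite := by
  algebraize [f]
  have hint : Algebra.IsIntegral R S := ⟨fun s => by
    obtain ⟨r, hr⟩ := h s
    exact IsIntegral.of_pow (Nat.pos_of_ne_zero hp) (hr ▸ isIntegral_algebraMap)⟩
  obtain ⟨σ, hσ⟩ := (Algebra.essFiniteType_iff R S).mp hf
  have htop : Algebra.adjoin R (σ : Set S) = ⊤ := by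
    refine eq_top_iff.mpr fun s _ => ?_
    obtain ⟨t, ht, ⟨t, rfl⟩, hst⟩ := hσ s
    obtain ⟨r, hr⟩ := h (t⁻¹ : Sˣ)
    have h1 : (s * t) * t ^ (p - 1) * algebraMap R S r ∈ Algebra.adjoin R (σ : Set S) :=
      mul_mem (mul_mem hst (pow_mem ht _)) (Subalgebra.algebraMap_mem _ r)
    have h2 : (s * t) * t ^ (p - 1) * algebraMap R S r = s := by
      have h3 : algebraMap R S r = ((t⁻¹ : Sˣ) : S) ^ p := hr
      have h4 : (t : S) * t ^ (p - 1) = t ^ p := mul_pow_sub_one hp _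
      rw [h3, mul_assoc s, h4, mul_assoc, ← mul_pow, Units.mul_inv, one_pow, mul_one]
    rwa [h2] at h1
  have : Algebra.FiniteType R S := ⟨⟨σ, htop⟩⟩
  exact Algebra.IsIntegral.finite

theorem frobenius_finite_of_essFiniteType (p : ℕ) [Fact p.Prime] {A B : Type*} [CommRing A]
    [CommRing B] [CharP A p] [CharP B p] (g : A →+* B) (hg : g.EssFiniteType)
    (hA : (frobenius A p).Finite) : (frobenius B p).Finite := by
  refine finite_of_essFiniteType_of_pow _ ?_ (Fact.out : p.Prime).ne_zero fun s => ⟨s, rfl⟩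
  have h1 : (frobenius B p).comp g = g.comp (frobenius A p) := by
    ext x; simp [frobenius_def]
  have h2 : ((frobenius B p).comp g).EssFiniteType := by
    rw [h1]
    exact hA.finiteType.essFiniteType.comp hg
  exact h2.of_comp

/-- A normal Noetherian domain is the intersection of its localizations at primes of height one:
if the denominators of `x` lie in a prime `I`, then they lie in a prime of height one contained in
`I`. -/
theorem exists_height_one_of_denominators_le {A K : Type*} [CommRing A] [IsDomain A]
    [IsNoetherianRing A] [IsIntegrallyClosed A] [Field K] [Algebra A K] [IsFractionRing A K]
    (x : K) (I : Ideal A) [I.IsPrime] (h : ∀ s a : A, algebraMap A K s * x = algebraMap A K a →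
      s ∈ I) :
    ∃ Q : Ideal A, Q.IsPrime ∧ Q.height = 1 ∧ Q ≤ I ∧
      ∀ s a : A, algebraMap A K s * x = algebraMap A K a → s ∈ Q := by
  obtain ⟨c, b, hb, rfl⟩ := IsFractionRing.div_surjective (A := A) x
  have hbK : algebraMap A K b ≠ 0 := IsFractionRing.to_map_ne_zero_of_mem_nonZeroDivisors hb
  have hden : ∀ c s a : A, algebraMap A K s * (algebraMap A K c / algebraMap A K b) =
      algebraMap A K a ↔ s * c = a * b := fun c s a => by
    rw [← mul_div_assoc, div_eq_iff hbK, ← map_mul, ← map_mul,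
      (IsFractionRing.injective A K).eq_iff]
  simp only [hden] at h ⊢
  let J : Submodule A A := Ideal.span {b}
  have hcolon : ∀ c s : A, s ∈ J.colon {c} ↔ ∃ a, s * c = a * b := fun c s => by
    rw [Submodule.mem_colon_singleton, smul_eq_mul, Ideal.mem_span_singleton']
    exact ⟨fun ⟨a, ha⟩ => ⟨a, ha.symm⟩, fun ⟨a, ha⟩ => ⟨a, ha.symm⟩⟩
  have hle : J.colon {c} ≤ I := fun s hs => by
    obtain ⟨a, ha⟩ := (hcolon c s).mp hs
    exact h s a ha
  obtain ⟨Q, hQ, hQI⟩ := Ideal.exists_minimalPrimes_le hle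
  have hQp : Q.IsPrime := hQ.1.1
  have hQc : ∀ s a : A, s * c = a * b → s ∈ Q := fun s a hsa =>
    hQ.1.2 ((hcolon c s).mpr ⟨a, hsa⟩)
  -- The denominators of `c / b` form the ideal `(b) : c`; a minimal prime over it is an associated
  -- prime `(b) : d`.
  obtain ⟨d, rfl⟩ := Submodule.exists_eq_colon_of_mem_minimalPrimes hQ
  set Q := J.colon {d}
  have hb0 : b ≠ 0 := nonZeroDivisors.ne_zero hb
  have hbQ : b ∈ Q := (hcolon d b).mpr ⟨d, mul_comm _ _⟩
  refine ⟨Q, hQp, le_antisymm ?_ ?_, hQI, hQc⟩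
  · let x : K := algebraMap A K d / algebraMap A K b
    have hx : ∀ s a : A, x * algebraMap A K s = algebraMap A K a ↔ s * d = a * b := fun s a => by
      rw [mul_comm, hden]
    let M := Submodule.map (Algebra.linearMap A K) Q
    -- If `x = d / b` maps `Q` to itself, it is integral, hence in `A`, and `Q` is the unit ideal.
    -- Otherwise `x a₀ = s` with `s ∉ Q`; then `s Q ⊆ (a₀)`, so `Q` is minimal over `(a₀)` and
    -- Krull's theorem bounds its height.
    by_cases hxM : ∀ y ∈ M, x • y ∈ M
    · exfalso
      have hint : IsIntegral A x := by
        refine isIntegral_of_smul_mem_submodule M ?_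
          (Submodule.FG.map _ (IsNoetherian.noetherian Q)) x hxM
        rw [Submodule.ne_bot_iff]
        exact ⟨_, ⟨b, hbQ, rfl⟩, hbK⟩
      obtain ⟨y, hy⟩ := IsIntegrallyClosed.algebraMap_eq_of_integral hint
      refine hQp.ne_top ((Ideal.eq_top_iff_one _).mpr ((hcolon d 1).mpr ⟨y, ?_⟩))
      rw [← hx, hy, map_one, mul_one]
    · push Not at hxM
      obtain ⟨_, ⟨a₀, ha₀, rfl⟩, hxa⟩ := hxM
      obtain ⟨s, hs⟩ := (hcolon d a₀).mp ha₀
      have hsQ : s ∉ Q := fun hsQ => hxa ⟨s, hsQ, ((hx a₀ s).mpr hs).symm⟩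
      refine Ideal.height_le_one_of_isPrincipal_of_mem_minimalPrimes (Ideal.span {a₀}) Q ?_
      refine ⟨⟨hQp, (Ideal.span_singleton_le_iff_mem Q).mpr ha₀⟩, fun P hP hPQ a ha => ?_⟩
      obtain ⟨r, hr⟩ := (hcolon d a).mp ha
      have h1 : s * a = r * a₀ := by
        apply mul_right_cancel₀ hb0
        calc s * a * b = a * (s * b) := by ring
          _ = r * a₀ * b := by rw [← hs]; linear_combination a₀ * hr
      have h2 : s * a ∈ P := by
        rw [h1]
        exact P.mul_mem_left r (hP.2 (Ideal.mem_span_singleton_self a₀))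
      exact (hP.1.mem_or_mem h2).resolve_left fun hsP => hsQ (hPQ hsP)
  · rw [Order.one_le_iff_ne_zero, Ne, Ideal.height_eq_zero_iff_eq_bot]
    exact fun h => hb0 ((Submodule.eq_bot_iff _).mp h b hbQ)

/-! ### Transport of structure to the image of a ring in a field -/

section Range

variable {S L : Type*} [CommRing S] [Field L] (j : S →+* L) (hj : Function.Injective j)

include hj in
theorem isDiscreteValuationRing_range [IsDomain S] [IsDiscreteValuationRing S] :
    IsDiscreteValuationRing j.range :=
  IsDiscreteValuationRing.RingEquivClass.isDiscreteValuationRing (RingEquiv.ofBijective j.rangeRestrict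
    ⟨fun _ _ h => hj (congrArg Subtype.val h), j.rangeRestrict_surjective⟩)

theorem isFractionRing_range (h : ∀ x : L, ∃ a b, j b ≠ 0 ∧ x = j a / j b) :
    IsFractionRing j.range L := by
  refine IsFractionRing.of_field _ _ fun x => ?_
  obtain ⟨a, b, -, rfl⟩ := h x
  exact ⟨⟨j a, a, rfl⟩, ⟨j b, b, rfl⟩, rfl⟩

theorem charP_range (p : ℕ) [CharP L p] : CharP j.range p :=
  ⟨fun n => by
    rw [← CharP.cast_eq_zero_iff L p, ← map_natCast j.range.subtype,
      map_eq_zero_iff _ (Subtype.val_injective : Function.Injective j.range.subtype)]⟩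

theorem frobenius_range_finite (p : ℕ) [Fact p.Prime] [CharP S p] [CharP j.range p]
    (h : (frobenius S p).Finite) : (frobenius j.range p).Finite := by
  refine RingHom.Finite.of_comp_finite (f := j.rangeRestrict) ?_
  have : (frobenius j.range p).comp j.rangeRestrict = j.rangeRestrict.comp (frobenius S p) := by
    ext x; simp [frobenius_def]
  rw [this]
  exact (RingHom.Finite.of_surjective _ j.rangeRestrict_surjective).comp h

end Range

/-- A `p⁻ᵉ`-linear map defined on a fractional ideal containing the ring extends to the fraction
field. -/
theorem exists_extension (p e : ℕ) [Fact p.Prime] {A K : Type u} [CommRing A] [IsDomain A]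
    [CharP A p] [Field K] [Algebra A K] [IsFractionRing A K] (M : Submodule A K) (h1 : 1 ∈ M)
    (ψ : Root p e M →ₗ[A] A) : ∃ Ψ : K →+ K, (∀ a g, Ψ (a ^ p ^ e * g) = a * Ψ g) ∧
      ∀ m : M, Ψ m = algebraMap A K (ψ (root p e m)) := by
  have hpos : p ^ e ≠ 0 := pow_ne_zero _ (Fact.out : p.Prime).ne_zero
  have hCh : CharP K p := charP_of_injective_algebraMap (IsFractionRing.injective A K) p
  have hM : ∀ a : A, algebraMap A K a ∈ M := fun a => by
    simpa [Algebra.smul_def] using M.smul_mem a h1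
  have hMa : ∀ (a : A) (g : K), g ∈ M → algebraMap A K a * g ∈ M := fun a g hg => by
    simpa [Algebra.smul_def] using M.smul_mem a hg
  classical
  let φ : K → K := fun g =>
    if hg : g ∈ M then algebraMap A K (ψ (root p e (⟨g, hg⟩ : M))) else 0
  have hφ : ∀ (g : K) (hg : g ∈ M), φ g = algebraMap A K (ψ (root p e (⟨g, hg⟩ : M))) :=
    fun g hg => dif_pos hg
  have hφadd : ∀ g g', g ∈ M → g' ∈ M → φ (g + g') = φ g + φ g' := fun g g' hg hg' => by
    rw [hφ g hg, hφ g' hg', hφ _ (add_mem hg hg'), ← map_add, ← map_add]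
    rfl
  have hφmul : ∀ (a : A) (g), g ∈ M → φ (algebraMap A K a ^ p ^ e * g) = algebraMap A K a * φ g := by
    intro a g hg
    have h2 : algebraMap A K a ^ p ^ e * g ∈ M := by
      rw [← map_pow]; exact hMa _ _ hg
    have h3 : root p e (⟨_, h2⟩ : M) = a • root p e (⟨g, hg⟩ : M) := by
      apply Subtype.ext
      change algebraMap A K a ^ p ^ e * g = (a ^ p ^ e) • g
      rw [Algebra.smul_def, map_pow]
    rw [hφ g hg, hφ _ h2, h3, map_smul, smul_eq_mul, map_mul]
  have hden : ∀ g : K, ∃ s : A, algebraMap A K s ≠ 0 ∧ algebraMap A K s ^ p ^ e * g ∈ M := by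
    intro g
    obtain ⟨a, b, hb, rfl⟩ := IsFractionRing.div_surjective (A := A) g
    have hb0 : algebraMap A K b ≠ 0 := IsFractionRing.to_map_ne_zero_of_mem_nonZeroDivisors hb
    refine ⟨b, hb0, ?_⟩
    have : algebraMap A K b ^ p ^ e * (algebraMap A K a / algebraMap A K b) =
        algebraMap A K (b ^ (p ^ e - 1) * a) := by
      rw [map_mul, map_pow, ← pow_sub_one_mul hpos]
      field_simp
    rw [this]
    exact hM _
  choose s hs0 hs using hden
  let Ψ : K → K := fun g => φ (algebraMap A K (s g) ^ p ^ e * g) / algebraMap A K (s g)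
  -- Independence of the denominator: semilinearity lets two choices be compared over their product.
  have hΨ : ∀ (g : K) (t : A), algebraMap A K t ≠ 0 → algebraMap A K t ^ p ^ e * g ∈ M →
      Ψ g = φ (algebraMap A K t ^ p ^ e * g) / algebraMap A K t := by
    intro g t ht htg
    simp only [Ψ]
    rw [div_eq_div_iff (hs0 g) ht, mul_comm, ← hφmul _ _ (hs g), mul_comm _ (algebraMap A K (s g)),
      ← hφmul _ _ htg]
    congr 1
    ring
  refine ⟨AddMonoidHom.mk' Ψ fun g g' => ?_, fun a g => ?_, fun m => ?_⟩
  · have h2 : algebraMap A K (s g * s g') ^ p ^ e * g ∈ M := by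
      rw [map_mul, mul_pow, mul_right_comm, mul_comm, ← map_pow]
      exact hMa _ _ (hs g)
    have h3 : algebraMap A K (s g * s g') ^ p ^ e * g' ∈ M := by
      rw [map_mul, mul_pow, mul_assoc, ← map_pow]
      exact hMa _ _ (hs g')
    have h0 : algebraMap A K (s g * s g') ≠ 0 := by
      rw [map_mul]; exact mul_ne_zero (hs0 g) (hs0 g')
    rw [hΨ g _ h0 h2, hΨ g' _ h0 h3, hΨ (g + g') _ h0 (by rw [mul_add]; exact add_mem h2 h3),
      mul_add, hφadd _ _ h2 h3, add_div]
  · simp only [AddMonoidHom.mk'_apply]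
    have key : ∀ (a : A) (g : K), Ψ (algebraMap A K a ^ p ^ e * g) = algebraMap A K a * Ψ g := by
      intro a g
      have h2 : algebraMap A K (s g) ^ p ^ e * (algebraMap A K a ^ p ^ e * g) =
        algebraMap A K a ^ p ^ e * (algebraMap A K (s g) ^ p ^ e * g) := by ring
      rw [hΨ _ (s g) (hs0 g), h2, hφmul _ _ (hs g), mul_div_assoc]
      rw [h2, ← map_pow]
      exact hMa _ _ (hs g)
    obtain ⟨a, b, hb, rfl⟩ := IsFractionRing.div_surjective (A := A) a
    have hb0 : algebraMap A K b ≠ 0 := IsFractionRing.to_map_ne_zero_of_mem_nonZeroDivisors hb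
    have h2 : algebraMap A K b ^ p ^ e * ((algebraMap A K a / algebraMap A K b) ^ p ^ e * g) =
        algebraMap A K a ^ p ^ e * g := by
      rw [← mul_assoc, ← mul_pow, mul_div_cancel₀ _ hb0]
    have h3 := key b ((algebraMap A K a / algebraMap A K b) ^ p ^ e * g)
    rw [h2, key] at h3
    rw [div_mul_eq_mul_div, h3, mul_div_cancel_left₀ _ hb0]
  · simp only [AddMonoidHom.mk'_apply]
    rw [hΨ m 1 (by simp) (by simp), ← hφ m m.2]
    simp

end CommutativeAlgebra


/-! ### Orders along prime divisors -/

section Order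

variable {X : Scheme.{u}} [IsIntegral X] [IsLocallyNoetherian X] [IsNormalScheme X]

omit [IsNormalScheme X] in
theorem ord_one (x : X) : Scheme.ord (1 : X.functionField) x = 0 := by
  have := Scheme.ord_mul (x := x) (one_ne_zero (α := X.functionField)) one_ne_zero
  rw [mul_one] at this
  omega

omit [IsNormalScheme X] in
theorem ord_pow (x : X) {g : X.functionField} (hg : g ≠ 0) (n : ℕ) :
    Scheme.ord (g ^ n) x = n * Scheme.ord g x := by
  induction n with
  | zero => simp [ord_one]
  | succ n ih => rw [pow_succ, Scheme.ord_mul (pow_ne_zero n hg) hg, ih]; push_cast; ring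

omit [IsNormalScheme X] in
theorem ord_inv (x : X) {g : X.functionField} (hg : g ≠ 0) :
    Scheme.ord g⁻¹ x = - Scheme.ord g x := by
  have := Scheme.ord_mul (x := x) hg (inv_ne_zero hg)
  rw [mul_inv_cancel₀ hg, ord_one] at this
  omega

omit [IsNormalScheme X] in
theorem ord_zpow (x : X) {g : X.functionField} (hg : g ≠ 0) (n : ℤ) :
    Scheme.ord (g ^ n) x = n * Scheme.ord g x := by
  cases n with
  | ofNat n => simpa using ord_pow x hg n
  | negSucc n =>
    rw [zpow_negSucc, ord_inv x (pow_ne_zero _ hg), ord_pow x hg, Int.negSucc_eq]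
    push_cast
    ring

omit [IsNormalScheme X] in
theorem ord_prod (x : X) {ι : Type*} (s : Finset ι) (g : ι → X.functionField)
    (hg : ∀ i ∈ s, g i ≠ 0) : Scheme.ord (∏ i ∈ s, g i) x = ∑ i ∈ s, Scheme.ord (g i) x := by
  classical
  induction s using Finset.induction_on with
  | empty => simp [ord_one]
  | insert a s ha ih =>
    rw [Finset.prod_insert ha, Finset.sum_insert ha, Scheme.ord_mul (hg a (by simp))
      (Finset.prod_ne_zero_iff.mpr fun i hi => hg i (by simp [hi])),
      ih fun i hi => hg i (by simp [hi])]

theorem ord_nonneg_iff (E : PrimeDivisor X) {g : X.functionField} (hg : g ≠ 0) :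
    0 ≤ Scheme.ord g E.1 ↔
      ∃ s : X.presheaf.stalk E.1, algebraMap (X.presheaf.stalk E.1) X.functionField s = g := by
  have := isDiscreteValuationRing_stalk X E
  rw [Scheme.le_ord_iff E.2 hg]
  constructor
  · intro h
    rw [Scheme.ordHom, Ring.ordFrac_eq_valuation_inv] at h
    refine IsDiscreteValuationRing.exists_lift_of_le_one ?_
    have h0 : (IsDiscreteValuationRing.maximalIdeal (X.presheaf.stalk E.1)).valuation
        X.functionField g ≠ 0 := (map_ne_zero _).mpr hg
    exact (one_le_inv₀ (zero_lt_iff.mpr h0)).mp (by simpa using h)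
  · rintro ⟨s, rfl⟩
    have : Ring.KrullDimLE 1 (X.presheaf.stalk E.1) := krullDimLE_of_coheight_le E.2.le
    exact Ring.ordFrac_ge_one_of_ne_zero (R := X.presheaf.stalk E.1)
      (fun h => hg (by rw [h, map_zero]))

theorem exists_ord_eq_one (E : PrimeDivisor X) :
    ∃ t : X.functionField, t ≠ 0 ∧ Scheme.ord t E.1 = 1 := by
  have := isDiscreteValuationRing_stalk X E
  obtain ⟨t, ht⟩ := IsDiscreteValuationRing.exists_irreducible (X.presheaf.stalk E.1)
  have h0 : algebraMap (X.presheaf.stalk E.1) X.functionField t ≠ 0 :=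
    (map_ne_zero_iff _ (IsFractionRing.injective _ _)).mpr ht.ne_zero
  exact ⟨_, h0, (Scheme.ord_eq_iff E.2 h0).mpr (Ring.ordFrac_irreducible ht)⟩

theorem ord_pos_iff (E : PrimeDivisor X) {s : X.presheaf.stalk E.1} (hs : s ≠ 0) :
    0 < Scheme.ord (algebraMap _ X.functionField s) E.1 ↔ ¬ IsUnit s := by
  have hinj := IsFractionRing.injective (X.presheaf.stalk E.1) X.functionField
  have h0 : algebraMap (X.presheaf.stalk E.1) X.functionField s ≠ 0 :=
    (map_ne_zero_iff _ hinj).mpr hs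
  have h1 := (ord_nonneg_iff E h0).mpr ⟨s, rfl⟩
  rw [← not_le, not_iff_not]
  constructor
  swap
  · rintro ⟨u, rfl⟩
    have h2 : algebraMap (X.presheaf.stalk E.1) X.functionField (u⁻¹ : (X.presheaf.stalk E.1)ˣ) =
        (algebraMap (X.presheaf.stalk E.1) X.functionField u)⁻¹ := by
      exact eq_inv_of_mul_eq_one_left (by rw [← map_mul, Units.inv_mul, map_one])
    have h3 := (ord_nonneg_iff E (inv_ne_zero h0)).mpr ⟨_, h2⟩
    rw [ord_inv _ h0] at h3
    omega
  · intro h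
    obtain ⟨r, hr⟩ := (ord_nonneg_iff E (inv_ne_zero h0)).mp (by rw [ord_inv _ h0]; omega)
    refine IsUnit.of_mul_eq_one r (hinj ?_)
    rw [map_mul, hr, mul_inv_cancel₀ h0, map_one]

end Order

/-! ### The spectrum of a normal domain -/

section Affine

variable (A : Type u) [CommRing A] [IsDomain A]

instance isFractionRing_functionField : IsFractionRing A (Spec (.of A)).functionField :=
  functionField_isFractionRing_of_affine (.of A)

/-- The ideal of a point of `Spec A`. -/
def pointIdeal {A : Type u} [CommRing A] (P : Spec (.of A)) : Ideal A := PrimeSpectrum.asIdeal P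

instance {A : Type u} [CommRing A] (P : Spec (.of A)) : (pointIdeal P).IsPrime :=
  PrimeSpectrum.isPrime P

variable {A}

omit [IsDomain A] in
theorem pointIdeal_height (P : Spec (.of A)) : (pointIdeal P).height = Order.coheight P :=
  idealHeight_eq_coheight (.of A) P

/-- The homomorphism from a ring to a local ring of its spectrum. -/
def toStalk (P : Spec (.of A)) : A →+* (Spec (.of A)).presheaf.stalk P :=
  ((Spec (.of A)).presheaf.germ ⊤ P trivial).hom.comp (Scheme.ΓSpecIso (.of A)).inv.hom

theorem algebraMap_toStalk (P : Spec (.of A)) (a : A) :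
    algebraMap ((Spec (.of A)).presheaf.stalk P) (Spec (.of A)).functionField (toStalk P a) =
      algebraMap A (Spec (.of A)).functionField a := by
  have : Nonempty (⊤ : (Spec (.of A)).Opens) := ⟨⟨genericPoint _, trivial⟩⟩
  exact Scheme.algebraMap_germ_eq_germToFunctionField (X := Spec (.of A)) (U := ⊤) (x := P) trivial _

omit [IsDomain A] in
theorem isLocalization_toStalk (P : Spec (.of A)) :
    letI := (toStalk P).toAlgebra
    IsLocalization.AtPrime ((Spec (.of A)).presheaf.stalk P) (pointIdeal P) :=
  StructureSheaf.IsLocalization.to_stalk A P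

omit [IsDomain A] in
theorem isUnit_toStalk_iff (P : Spec (.of A)) (a : A) :
    IsUnit (toStalk P a) ↔ a ∉ pointIdeal P := by
  let := (toStalk P).toAlgebra
  have := isLocalization_toStalk P
  exact IsLocalization.AtPrime.isUnit_to_map_iff ((Spec (.of A)).presheaf.stalk P) (pointIdeal P) a

theorem exists_algebraMap_mul_iff (P : Spec (.of A)) (x : (Spec (.of A)).functionField) :
    (∃ s : (Spec (.of A)).presheaf.stalk P, algebraMap _ (Spec (.of A)).functionField s = x) ↔
      ∃ s a : A, s ∉ pointIdeal P ∧ algebraMap A (Spec (.of A)).functionField s * x =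
        algebraMap A (Spec (.of A)).functionField a := by
  constructor
  · rintro ⟨r, rfl⟩
    let := (toStalk P).toAlgebra
    have := isLocalization_toStalk P
    obtain ⟨⟨a, s⟩, h⟩ := IsLocalization.surj (pointIdeal P).primeCompl r
    refine ⟨s, a, s.2, ?_⟩
    rw [← algebraMap_toStalk P, ← algebraMap_toStalk P, ← map_mul, mul_comm]
    exact congrArg _ h
  · rintro ⟨s, a, hs, h⟩
    obtain ⟨u, hu⟩ := (isUnit_toStalk_iff P s).mpr hs
    refine ⟨(u⁻¹ : (_)ˣ) * toStalk P a, ?_⟩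
    rw [map_mul, algebraMap_toStalk, ← h, ← algebraMap_toStalk P, ← hu, ← mul_assoc, ← map_mul,
      Units.inv_mul, map_one, one_mul]

variable [IsNoetherianRing A] [IsIntegrallyClosed A] (P : PrimeDivisor (Spec (.of A)))

theorem ord_nonneg_iff_exists {x : (Spec (.of A)).functionField} (hx : x ≠ 0) :
    0 ≤ Scheme.ord x P.1 ↔ ∃ s a : A, s ∉ pointIdeal P.1 ∧
      algebraMap A (Spec (.of A)).functionField s * x =
        algebraMap A (Spec (.of A)).functionField a := by
  rw [ord_nonneg_iff P hx, exists_algebraMap_mul_iff]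

omit [IsNoetherianRing A] [IsIntegrallyClosed A] in
theorem algebraMap_functionField_ne_zero {a : A} (ha : a ≠ 0) :
    algebraMap A (Spec (.of A)).functionField a ≠ 0 :=
  (map_ne_zero_iff _ (IsFractionRing.injective A _)).mpr ha

theorem ord_algebraMap_nonneg {a : A} (ha : a ≠ 0) :
    0 ≤ Scheme.ord (algebraMap A (Spec (.of A)).functionField a) P.1 :=
  (ord_nonneg_iff_exists P (algebraMap_functionField_ne_zero ha)).mpr
    ⟨1, a, (Ideal.ne_top_iff_one _).mp (Ideal.IsPrime.ne_top inferInstance), by simp⟩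

theorem ord_algebraMap_pos_iff {a : A} (ha : a ≠ 0) :
    0 < Scheme.ord (algebraMap A (Spec (.of A)).functionField a) P.1 ↔ a ∈ pointIdeal P.1 := by
  have h0 : toStalk P.1 a ≠ 0 := fun h => algebraMap_functionField_ne_zero ha (by
    rw [← algebraMap_toStalk P.1, h, map_zero])
  rw [← algebraMap_toStalk P.1, ord_pos_iff P h0, isUnit_toStalk_iff, not_not]

omit [IsNoetherianRing A] [IsIntegrallyClosed A] in
theorem pointIdeal_ne_bot : pointIdeal P.1 ≠ ⊥ :=
  Ideal.ne_bot_of_height_eq_one (by rw [pointIdeal_height, P.2])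

omit [IsIntegrallyClosed A] in
/-- There are no strict inclusions into a prime of height one except from zero. -/
theorem eq_pointIdeal_of_le {Q : Ideal A} [Q.IsPrime] (h0 : Q ≠ ⊥) (h : Q ≤ pointIdeal P.1) :
    Q = pointIdeal P.1 := by
  by_contra hne
  have hlt : Q < pointIdeal P.1 := lt_of_le_of_ne h hne
  have h1 : (pointIdeal P.1).height = 1 := by rw [pointIdeal_height, P.2]
  have hfin : (pointIdeal P.1).FiniteHeight := inferInstance
  have h2 := Ideal.height_strict_mono_of_isPrime hlt
  rw [h1, Order.lt_one_iff, Ideal.height_eq_zero_iff_eq_bot] at h2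
  exact h0 h2

omit [IsDomain A] [IsNoetherianRing A] [IsIntegrallyClosed A] in
theorem pointIdeal_injective {P Q : Spec (.of A)} (h : pointIdeal P = pointIdeal Q) : P = Q :=
  PrimeSpectrum.ext h

/-- An element of a prime divisor `P` can be freed of its poles along the other divisors by
multiplication with an element that does not vanish along `P`. -/
theorem exists_smul_ord_nonneg (g : (Spec (.of A)).functionField) (hg : g ≠ 0) :
    ∃ s : A, s ≠ 0 ∧ s ∉ pointIdeal P.1 ∧ ∀ Q : PrimeDivisor (Spec (.of A)), Q ≠ P →
      0 ≤ Scheme.ord (algebraMap A (Spec (.of A)).functionField s * g) Q.1 := by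
  classical
  obtain ⟨b, a, ha, rfl⟩ := IsFractionRing.div_surjective (A := A) g
  have ha0 : a ≠ 0 := nonZeroDivisors.ne_zero ha
  have haK := algebraMap_functionField_ne_zero ha0
  have hb0 : b ≠ 0 := fun h => hg (by rw [h, map_zero, zero_div])
  have hbK := algebraMap_functionField_ne_zero hb0
  -- The possible poles of `b / a` lie along height-one primes containing `a`; these are minimal
  -- over `(a)`, hence finitely many.
  let T : Set (PrimeDivisor (Spec (.of A))) := {Q | a ∈ pointIdeal Q.1}
  have hT : T.Finite := by
    refine Set.Finite.of_finite_image (f := fun Q => pointIdeal Q.1)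
      ((Ideal.finite_minimalPrimes_of_isNoetherianRing A (Ideal.span {a})).subset ?_) ?_
    · rintro _ ⟨Q, hQ, rfl⟩
      refine ⟨⟨inferInstance, (Ideal.span_singleton_le_iff_mem _).mpr hQ⟩, fun I hI hIQ => ?_⟩
      have := hI.1
      refine (eq_pointIdeal_of_le Q (fun h => ha0 ?_) hIQ).ge
      have := hI.2 (Ideal.mem_span_singleton_self a)
      rwa [h] at this
    · exact fun Q _ Q' _ h => Subtype.ext (pointIdeal_injective h)
  have hex : ∀ Q : PrimeDivisor (Spec (.of A)), Q ≠ P → ∃ s ∈ pointIdeal Q.1,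
      s ∉ pointIdeal P.1 := fun Q hQ => by
    by_contra! h
    exact hQ (Subtype.ext (pointIdeal_injective (eq_pointIdeal_of_le P (pointIdeal_ne_bot Q) h)))
  let s₀ : PrimeDivisor (Spec (.of A)) → A := fun Q => if hQ : Q ≠ P then (hex Q hQ).choose else 1
  have hs₀Q : ∀ Q, Q ≠ P → s₀ Q ∈ pointIdeal Q.1 := fun Q hQ => by
    simp only [s₀, dif_pos hQ]
    exact (hex Q hQ).choose_spec.1
  have hs₀P : ∀ Q, s₀ Q ∉ pointIdeal P.1 := fun Q => by
    by_cases hQ : Q ≠ P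
    · simp only [s₀, dif_pos hQ]
      exact (hex Q hQ).choose_spec.2
    · simp only [s₀, dif_neg hQ]
      exact (Ideal.ne_top_iff_one _).mp (Ideal.IsPrime.ne_top inferInstance)
  -- Enough copies of an element vanishing on `Q` but not on `P` to cancel the whole order of `a`
  -- along `Q`.
  let N : PrimeDivisor (Spec (.of A)) → ℕ := fun Q =>
    (Scheme.ord (algebraMap A (Spec (.of A)).functionField a) Q.1).toNat
  let s : A := ∏ Q ∈ hT.toFinset, s₀ Q ^ N Q
  have hsP : s ∉ pointIdeal P.1 := by
    intro h
    obtain ⟨Q, -, hQ⟩ := (Ideal.IsPrime.prod_mem_iff).mp h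
    exact hs₀P Q (Ideal.IsPrime.mem_of_pow_mem inferInstance _ hQ)
  have hs0 : s ≠ 0 := fun h => hsP (h ▸ zero_mem _)
  refine ⟨s, hs0, hsP, fun Q hQ => ?_⟩
  have hsK := algebraMap_functionField_ne_zero hs0
  rw [Scheme.ord_mul hsK (div_ne_zero hbK haK), div_eq_mul_inv, Scheme.ord_mul hbK
    (inv_ne_zero haK), ord_inv _ haK]
  have h1 := ord_algebraMap_nonneg Q hb0
  suffices h : Scheme.ord (algebraMap A (Spec (.of A)).functionField a) Q.1 ≤
      Scheme.ord (algebraMap A (Spec (.of A)).functionField s) Q.1 by omega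
  by_cases haQ : a ∈ pointIdeal Q.1
  · have hs₀0 : ∀ R, s₀ R ≠ 0 := fun R h => hs₀P R (h ▸ zero_mem _)
    have h2 : s = s₀ Q ^ N Q * ∏ R ∈ hT.toFinset.erase Q, s₀ R ^ N R :=
      (Finset.mul_prod_erase _ _ (by simpa [T] using haQ)).symm
    have h3 : ∏ R ∈ hT.toFinset.erase Q, s₀ R ^ N R ≠ 0 :=
      Finset.prod_ne_zero_iff.mpr fun R _ => pow_ne_zero _ (hs₀0 R)
    rw [h2, map_mul, map_pow, Scheme.ord_mul (pow_ne_zero _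
      (algebraMap_functionField_ne_zero (hs₀0 Q))) (algebraMap_functionField_ne_zero h3),
      ord_pow _ (algebraMap_functionField_ne_zero (hs₀0 Q))]
    have h4 := ord_algebraMap_nonneg Q h3
    have h5 := (ord_algebraMap_pos_iff Q (hs₀0 Q)).mpr (hs₀Q Q hQ)
    have h6 : Scheme.ord (algebraMap A (Spec (.of A)).functionField a) Q.1 ≤ N Q :=
      Int.self_le_toNat _
    have h7 : (N Q : ℤ) * 1 ≤
        N Q * Scheme.ord (algebraMap A (Spec (.of A)).functionField (s₀ Q)) Q.1 := by
      gcongr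
      omega
    linarith
  · rw [← ord_algebraMap_pos_iff Q ha0] at haQ
    have := ord_algebraMap_nonneg Q hs0
    omega

/-- A rational function without poles along the prime divisors through a point is regular at that
point. -/
theorem exists_algebraMap_of_ord_nonneg (y : Spec (.of A)) (U : (Spec (.of A)).Opens) (hy : y ∈ U)
    {x : (Spec (.of A)).functionField} (hx : x ≠ 0)
    (h : ∀ P : PrimeDivisor (Spec (.of A)), P.1 ∈ U → 0 ≤ Scheme.ord x P.1) :
    ∃ s : (Spec (.of A)).presheaf.stalk y, algebraMap _ (Spec (.of A)).functionField s = x := by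
  rw [exists_algebraMap_mul_iff]
  by_contra! hcon
  obtain ⟨Q, hQ, hQ1, hQy, hQx⟩ := exists_height_one_of_denominators_le (A := A) x (pointIdeal y)
    (fun s a hsa => by_contra fun hs => hcon s a hs hsa)
  let P : Spec (.of A) := (⟨Q, hQ⟩ : PrimeSpectrum A)
  have hP : Order.coheight P = 1 := by rw [← pointIdeal_height]; exact hQ1
  -- `Q` is contained in the ideal of `y`, so `P` specializes to `y` and lies in every neighbourhood
  -- of `y`.
  have hPU : P ∈ U := by
    have : P ⤳ y := (PrimeSpectrum.le_iff_specializes (⟨Q, hQ⟩ : PrimeSpectrum A) y).mp hQy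
    exact this.mem_open U.isOpen hy
  obtain ⟨s, a, hs, hsa⟩ := (ord_nonneg_iff_exists ⟨P, hP⟩ hx).mp (h ⟨P, hP⟩ hPU)
  exact hs (hQx s a hsa)

end Affine


/-! ### Birational morphisms and function fields -/

section Birational

theorem isIso_stalkMap_of_comp {U X Y : Scheme.{u}} (j : U ⟶ X) (f : X ⟶ Y) [IsOpenImmersion j]
    [IsOpenImmersion (j ≫ f)] (x : U) : IsIso (f.stalkMap (j x)) := by
  have h1 : IsIso (f.stalkMap (j x) ≫ j.stalkMap x) := by
    rw [← Scheme.Hom.stalkMap_comp]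
    exact (IsOpenImmersion.iff_isIso_stalkMap.mp inferInstance).2 x
  have h2 : IsIso (j.stalkMap x) := (IsOpenImmersion.iff_isIso_stalkMap.mp inferInstance).2 x
  exact IsIso.of_isIso_comp_right (f.stalkMap (j x)) (j.stalkMap x)

theorem isIso_stalkMap_of_isBirationalMorphism {X Y : Scheme.{u}} [IsIntegral X] (f : X ⟶ Y)
    [hf : IsBirationalMorphism f] : IsIso (f.stalkMap (genericPoint X)) := by
  obtain ⟨e, he⟩ := hf.birationalOver
  have h : e.iso.hom ≫ e.target.ι = e.source.ι ≫ f := by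
    simpa [Scheme.PartialIso.IsOver] using he
  have hx : genericPoint X ∈ e.source :=
    ((genericPoint_spec X).mem_open_set_iff e.source.isOpen).mpr
      (by simpa using e.dense_source.nonempty)
  have : IsOpenImmersion (e.source.ι ≫ f) := h ▸ inferInstance
  obtain ⟨x, hx⟩ : ∃ x, e.source.ι x = genericPoint X := ⟨⟨genericPoint X, hx⟩, rfl⟩
  rw [← hx]
  exact isIso_stalkMap_of_comp e.source.ι f x

variable {X Y : Scheme.{u}} [IsIntegral X] [IsIntegral Y] (f : X ⟶ Y)

theorem functionFieldMap_bijective [IsBirationalMorphism f] :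
    Function.Bijective (functionFieldMap f) := by
  have h1 := isIso_stalkMap_of_isBirationalMorphism f
  have h2 : IsIso (Y.presheaf.stalkSpecializes (specializes_of_eq (map_genericPoint f))) :=
    (Y.presheaf.stalkCongr (.of_eq (map_genericPoint f).symm)).isIso_hom
  have h3 : IsIso (Y.presheaf.stalkSpecializes (specializes_of_eq (map_genericPoint f)) ≫
    f.stalkMap (genericPoint X)) := inferInstance
  exact ConcreteCategory.bijective_of_isIso (C := CommRingCat) (Y.presheaf.stalkSpecializes
    (specializes_of_eq (map_genericPoint f)) ≫ f.stalkMap (genericPoint X))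

theorem functionFieldMap_algebraMap [IsDominant f] (x : X) (s : Y.presheaf.stalk (f x)) :
    functionFieldMap f (algebraMap _ Y.functionField s) =
      algebraMap _ X.functionField (f.stalkMap x s) := by
  have hX : genericPoint X ⤳ x := (genericPoint_spec X).specializes trivial
  have hY : genericPoint Y ⤳ f x := (genericPoint_spec Y).specializes trivial
  have h : Y.presheaf.stalkSpecializes hY ≫
      Y.presheaf.stalkSpecializes (specializes_of_eq (map_genericPoint f)) ≫
        f.stalkMap (genericPoint X) = f.stalkMap x ≫ X.presheaf.stalkSpecializes hX := by
    rw [← Scheme.Hom.stalkSpecializes_stalkMap, ← Category.assoc,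
      TopCat.Presheaf.stalkSpecializes_comp]
  exact congrArg (fun φ => φ.hom s) h

end Birational

/-! ### The Cartier operator along a prime divisor -/

section Divisor

variable {Z : Scheme.{u}} [IsIntegral Z] [IsLocallyNoetherian Z] [IsNormalScheme Z]
  {L : Type u} [Field L] {p : ℕ} [Fact p.Prime] [CharP L p]
  {ι : Z.functionField →+* L} (hι : Function.Surjective ι) {η : TopForm L}
  {K : WeilDivisor Z ℤ} (hK : IsCanonicalDivisor Z ι η K) (E : PrimeDivisor Z)
  [CharP (Z.presheaf.stalk E.1) p] (hE : (frobenius (Z.presheaf.stalk E.1) p).Finite)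
  {C : TopForm L →+ TopForm L} (hC : IsCartierOperator p C)

/-- The local ring at a prime divisor as a subring of the ambient field. -/
abbrev localSubring (ι : Z.functionField →+* L) (E : PrimeDivisor Z) : Subring L :=
  (ι.comp (algebraMap (Z.presheaf.stalk E.1) Z.functionField)).range

omit [IsNormalScheme Z] [IsLocallyNoetherian Z] in
theorem injective_comp_algebraMap :
    Function.Injective (ι.comp (algebraMap (Z.presheaf.stalk E.1) Z.functionField)) :=
  ι.injective.comp (IsFractionRing.injective _ _)

instance : IsDiscreteValuationRing (localSubring ι E) :=
  have := isDiscreteValuationRing_stalk Z E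
  isDiscreteValuationRing_range _ (injective_comp_algebraMap E)

include hι in
omit [IsNormalScheme Z] [IsLocallyNoetherian Z] in
theorem isFractionRing_localSubring : IsFractionRing (localSubring ι E) L := by
  refine isFractionRing_range _ fun x => ?_
  obtain ⟨x, rfl⟩ := hι x
  obtain ⟨a, b, hb, rfl⟩ := IsFractionRing.div_surjective (A := Z.presheaf.stalk E.1) x
  refine ⟨a, b, ?_, by simp⟩
  rw [map_ne_zero_iff _ (injective_comp_algebraMap E)]
  exact nonZeroDivisors.ne_zero hb

include hι hE in
theorem exists_isPBasis_localSubring :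
    0 < Module.finrank L Ω[L⁄ℤ] ∧ ∃ z : Fin (Module.finrank L Ω[L⁄ℤ]) → L, IsPBasis p z := by
  have := isFractionRing_localSubring hι E
  have : CharP (localSubring ι E) p := charP_range _ p
  obtain ⟨h, z, -, hz⟩ := exists_isPBasis_of_dvr (p := p) (localSubring ι E)
    (frobenius_range_finite _ p hE)
  exact ⟨h, _, hz⟩

include hι hK hE hC

/-- If the Cartier operator takes `x η` to `η`, then `x` does not vanish too much. -/
theorem ord_add_lt_of_iterate_eq (e : ℕ) {x : Z.functionField} (hx : x ≠ 0)
    (h : C^[e] (ι x • η) = η) :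
    Scheme.ord x E.1 + K E < p ^ e * (K E + 1) := by
  have := isFractionRing_localSubring hι E
  have : CharP (localSubring ι E) p := charP_range _ p
  by_contra! hcon
  obtain ⟨t, ht0, ht⟩ := exists_ord_eq_one E
  -- The least exponent for which `t ^ (-l) η` is not regular. If `x` vanished too much, `t ^ (-l q)
  -- x η` would be regular, and so would its image `t ^ (-l) η`.
  let l : ℤ := K E + 1
  have htl : ∀ n : ℤ, t ^ n ≠ 0 := fun n => zpow_ne_zero n ht0
  have hreg : ι ((t ^ (-l)) ^ p ^ e * x) • η ∈ regularForms (localSubring ι E) := by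
    refine (hK E _).mpr (Or.inr ?_)
    rw [Scheme.ord_mul (pow_ne_zero _ (htl _)) hx, ord_pow _ (htl _), ord_zpow _ ht0, ht]
    push_cast
    simp only [l]
    linarith
  have h1 := hC.iterate_mem_regularForms _ (frobenius_range_finite _ p hE) e hreg
  rw [map_mul, map_pow, mul_smul, hC.iterate_map_pow_smul, h] at h1
  rcases (hK E _).mp h1 with h2 | h2
  · exact htl _ h2
  · rw [ord_zpow _ ht0, ht] at h2
    simp only [l] at h2
    omega

/-- If the Cartier operator maps the fractional ideal generated by `x` to regular functions, then
`x` vanishes along the canonical divisor. -/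
theorem le_ord_of_iterate_mem (e : ℕ) (j : ℤ) {x : Z.functionField} (hx : x ≠ 0)
    (h : ∀ g : Z.functionField, g ≠ 0 → -j ≤ Scheme.ord g E.1 →
      ∃ s : Z.presheaf.stalk E.1, C^[e] (ι (x * g) • η) = ι (algebraMap _ _ s) • η) :
    (p ^ e - 1) * K E + j ≤ Scheme.ord x E.1 := by
  have := isFractionRing_localSubring hι E
  have : CharP (localSubring ι E) p := charP_range _ p
  obtain ⟨t, ht0, ht⟩ := exists_ord_eq_one E
  have htl : ∀ n : ℤ, t ^ n ≠ 0 := fun n => zpow_ne_zero n ht0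
  -- Multiples of `x t ^ (-j) η` by functions regular along `E` go to such multiples of `η`, and `t
  -- ^ (-K E) η` is still regular. Duality then gives regularity before applying `C^[e]`, and orders
  -- can be compared.
  have hreg : ι ((t ^ (-K E)) ^ p ^ e * (x * t ^ (-j))) • η ∈ regularForms (localSubring ι E) := by
    refine hC.mem_regularForms_of_iterate _ (frobenius_range_finite _ p hE) e ?_
    rintro ⟨_, s, rfl⟩
    have e1 : ((ι.comp (algebraMap (Z.presheaf.stalk E.1) Z.functionField)) s) •
        ι ((t ^ (-K E)) ^ p ^ e * (x * t ^ (-j))) • η =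
        ι (t ^ (-K E)) ^ p ^ e • ι (x * (t ^ (-j) * algebraMap _ _ s)) • η := by
      rw [smul_smul, smul_smul, RingHom.comp_apply, ← map_mul, ← map_pow, ← map_mul]
      congr 2
      ring
    change C^[e] (((ι.comp (algebraMap (Z.presheaf.stalk E.1) Z.functionField)) s) • _) ∈ _
    rw [e1, hC.iterate_map_pow_smul]
    rcases eq_or_ne s 0 with rfl | hs
    · simp only [map_zero, mul_zero, zero_smul]
      rw [Function.iterate_fixed (map_zero C), smul_zero]
      exact zero_mem _
    have hs0 : algebraMap (Z.presheaf.stalk E.1) Z.functionField s ≠ 0 :=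
      (map_ne_zero_iff _ (IsFractionRing.injective _ _)).mpr hs
    obtain ⟨r, hr⟩ := h (t ^ (-j) * algebraMap _ _ s) (mul_ne_zero (htl _) hs0) (by
      have := (ord_nonneg_iff E hs0).mpr ⟨s, rfl⟩
      rw [Scheme.ord_mul (htl _) hs0, ord_zpow _ ht0, ht]
      omega)
    rw [hr, smul_smul, ← map_mul]
    refine (hK E _).mpr ?_
    rcases eq_or_ne r 0 with rfl | hr0
    · left; simp
    right
    have hr0' : algebraMap (Z.presheaf.stalk E.1) Z.functionField r ≠ 0 :=
      (map_ne_zero_iff _ (IsFractionRing.injective _ _)).mpr hr0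
    have := (ord_nonneg_iff E hr0').mpr ⟨r, rfl⟩
    rw [Scheme.ord_mul (htl _) hr0', ord_zpow _ ht0, ht]
    omega
  have hne : (t ^ (-K E)) ^ p ^ e * (x * t ^ (-j)) ≠ 0 :=
    mul_ne_zero (pow_ne_zero _ (htl _)) (mul_ne_zero hx (htl _))
  have h1 := ((hK E _).mp hreg).resolve_left hne
  rw [Scheme.ord_mul (pow_ne_zero _ (htl _)) (mul_ne_zero hx (htl _)), Scheme.ord_mul hx (htl _),
    ord_pow _ (htl _), ord_zpow _ ht0, ord_zpow _ ht0, ht] at h1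
  push_cast at h1
  linarith

end Divisor


/-! ### From a splitting to a rational function with bounded divisor -/

section Descent

variable {p : ℕ} {A : Type u} [CommRing A]

theorem charP_stalk {X : Scheme.{u}} [IsIntegral X] [CharP X.functionField p] (x : X) :
    CharP (X.presheaf.stalk x) p :=
  RingHom.charP (algebraMap (X.presheaf.stalk x) X.functionField)
    (IsFractionRing.injective _ _) p

variable [Fact p.Prime]

theorem frobenius_stalk_finite [CharP A p] (hA : (frobenius A p).Finite) (P : Spec (.of A))
    [CharP ((Spec (.of A)).presheaf.stalk P) p] :
    (frobenius ((Spec (.of A)).presheaf.stalk P) p).Finite := by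
  refine frobenius_finite_of_essFiniteType p (toStalk P) ?_ hA
  algebraize [toStalk P]
  have := isLocalization_toStalk P
  exact Algebra.EssFiniteType.of_isLocalization _ (pointIdeal P).primeCompl

theorem frobenius_stalk_finite_of_locallyOfFiniteType {X Y : Scheme.{u}} (f : X ⟶ Y)
    [LocallyOfFiniteType f] (x : X) [CharP (X.presheaf.stalk x) p]
    [CharP (Y.presheaf.stalk (f x)) p] (h : (frobenius (Y.presheaf.stalk (f x)) p).Finite) :
    (frobenius (X.presheaf.stalk x) p).Finite :=
  frobenius_finite_of_essFiniteType p (f.stalkMap x).hom (LocallyOfFiniteType.stalkMap f x) h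

variable [IsDomain A] [IsNoetherianRing A] [IsIntegrallyClosed A] [CharP A p]
  {Δ : WeilDivisor (Spec (.of A)) ℚ}

/-- A splitting extends to the function field. -/
theorem FrobeniusSplits.exists_addMonoidHom (hΔ : 0 ≤ Δ) {e : ℕ} {c : A}
    (h : FrobeniusSplits p Δ e c) :
    ∃ Ψ : (Spec (.of A)).functionField →+ (Spec (.of A)).functionField,
      (∀ x g, Ψ (x ^ p ^ e * g) = x * Ψ g) ∧
      (∀ m ∈ sections (((p : ℚ) ^ e - 1) • Δ), ∃ a : A, Ψ m = algebraMap A _ a) ∧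
      Ψ (algebraMap A _ c) = 1 := by
  obtain ⟨hc, ψ, hψ⟩ := h
  have hp : (1 : ℚ) ≤ (p : ℚ) ^ e :=
    one_le_pow₀ (by exact_mod_cast (Fact.out : p.Prime).one_lt.le)
  have h1 : (1 : (Spec (.of A)).functionField) ∈ sections (((p : ℚ) ^ e - 1) • Δ) := by
    intro _ P
    rw [ord_one]
    have : 0 ≤ ((p : ℚ) ^ e - 1) * Δ P := mul_nonneg (by linarith) (hΔ P)
    simpa using this
  obtain ⟨Ψ, hΨ, hΨψ⟩ := exists_extension p e _ h1 ψ
  refine ⟨Ψ, hΨ, fun m hm => ⟨_, hΨψ ⟨m, hm⟩⟩, ?_⟩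
  have h2 := LinearMap.congr_fun hψ 1
  rw [LinearMap.comp_apply, LinearMap.toSpanSingleton_apply, one_smul, LinearMap.id_apply] at h2
  exact (hΨψ ⟨_, hc⟩).trans (by rw [h2, map_one])

omit [CharP A p] in
/-- An inverse Frobenius semilinear map that is regular on global sections of a divisor is
regular on its sections near each prime divisor. -/
theorem exists_algebraMap_of_le_ord {e : ℕ} (hΔ : 0 ≤ Δ)
    {Ψ : (Spec (.of A)).functionField →+ (Spec (.of A)).functionField}
    (hΨ : ∀ x g, Ψ (x ^ p ^ e * g) = x * Ψ g)
    (hA : ∀ m ∈ sections (((p : ℚ) ^ e - 1) • Δ), ∃ a : A, Ψ m = algebraMap A _ a)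
    (P : PrimeDivisor (Spec (.of A))) {g : (Spec (.of A)).functionField} (hg : g ≠ 0)
    (h : -⌊((p : ℚ) ^ e - 1) * Δ P⌋ ≤ Scheme.ord g P.1) :
    ∃ s : (Spec (.of A)).presheaf.stalk P.1, algebraMap _ (Spec (.of A)).functionField s = Ψ g := by
  have hp : (1 : ℚ) ≤ (p : ℚ) ^ e :=
    one_le_pow₀ (by exact_mod_cast (Fact.out : p.Prime).one_lt.le)
  obtain ⟨s, hs0, hsP, hs⟩ := exists_smul_ord_nonneg P g hg
  have hsK := algebraMap_functionField_ne_zero hs0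
  -- The factor `s ^ q` clears the poles of `g` away from `P`. It leaves `Ψ` as `s`, which is a unit
  -- at `P`.
  obtain ⟨a, ha⟩ := hA (algebraMap A _ s ^ p ^ e * g) (fun _ Q => by
    have h0 : 0 ≤ ((p : ℚ) ^ e - 1) * Δ Q := mul_nonneg (by linarith) (hΔ Q)
    have h1 := ord_algebraMap_nonneg Q hs0
    have hq : 1 ≤ p ^ e := Nat.one_le_pow _ _ (Fact.out : p.Prime).pos
    rw [Finsupp.smul_apply, smul_eq_mul, Scheme.ord_mul (pow_ne_zero _ hsK) hg, ord_pow _ hsK]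
    have h2 : Scheme.ord (algebraMap A (Spec (.of A)).functionField s) Q.1 ≤
        (p ^ e : ℕ) * Scheme.ord (algebraMap A (Spec (.of A)).functionField s) Q.1 :=
      le_mul_of_one_le_left h1 (by exact_mod_cast hq)
    have h3 : -⌊((p : ℚ) ^ e - 1) * Δ Q⌋ ≤
        (p ^ e : ℕ) * Scheme.ord (algebraMap A (Spec (.of A)).functionField s) Q.1 +
          Scheme.ord g Q.1 := by
      rcases eq_or_ne Q P with rfl | hQ
      · omega
      · have h4 := hs Q hQ
        rw [Scheme.ord_mul hsK hg] at h4
        have h5 : (0 : ℤ) ≤ ⌊((p : ℚ) ^ e - 1) * Δ Q⌋ := Int.floor_nonneg.mpr h0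
        omega
    have h4 := Int.floor_le (((p : ℚ) ^ e - 1) * Δ Q)
    have h5 : (-⌊((p : ℚ) ^ e - 1) * Δ Q⌋ : ℚ) ≤
        (((p ^ e : ℕ) * Scheme.ord (algebraMap A (Spec (.of A)).functionField s) Q.1 +
          Scheme.ord g Q.1 : ℤ) : ℚ) := by exact_mod_cast h3
    linarith)
  rw [hΨ] at ha
  exact (exists_algebraMap_mul_iff P.1 _).mpr ⟨s, a, hsP, ha⟩

-- Such a `b` compensates the rounding of `(q - 1)Δ` for all `q` at once: the loss is less than one
-- along each component of `Δ` and nothing elsewhere.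
omit [IsNoetherianRing A] [IsIntegrallyClosed A] in
theorem exists_mem_pointIdeal (Δ : WeilDivisor (Spec (.of A)) ℚ) :
    ∃ b : A, b ≠ 0 ∧ ∀ P, Δ P ≠ 0 → b ∈ pointIdeal P.1 := by
  have h (P : PrimeDivisor (Spec (.of A))) : ∃ b ∈ pointIdeal P.1, b ≠ 0 :=
    Submodule.exists_mem_ne_zero_of_ne_bot (pointIdeal_ne_bot P)
  choose b hb hb0 using h
  refine ⟨∏ P ∈ Δ.support, b P, Finset.prod_ne_zero_iff.mpr fun P _ => hb0 P, fun P hP => ?_⟩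
  exact Ideal.mem_of_dvd _ (Finset.dvd_prod_of_mem b (Finsupp.mem_support_iff.mpr hP)) (hb P)

variable {X : Scheme.{u}} [IsIntegral X] [IsLocallyNoetherian X] [IsNormalScheme X]
  {f : X ⟶ Spec (.of A)} [LocallyOfFiniteType f] [IsBirationalMorphism f]
  {η : TopForm X.functionField} (hη : η ≠ 0)
  {KX : WeilDivisor X ℤ} (hKX : IsCanonicalDivisor X (RingHom.id X.functionField) η KX)
  {KY : WeilDivisor (Spec (.of A)) ℤ}
  (hKY : IsCanonicalDivisor (Spec (.of A)) (functionFieldMap f) η KY)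

include hη hKX hKY in
/-- A splitting along `c` is given by a rational function whose divisor on `Spec A` is bounded
below by the canonical divisor and the boundary and whose divisor on `X` is bounded above by the
canonical divisor. -/
theorem FrobeniusSplits.exists_ord_bounds (hA : IsFFinite p A) (hΔ : 0 ≤ Δ) {e : ℕ} {c : A}
    (hc : c ≠ 0) (h : FrobeniusSplits p Δ e c) (E : PrimeDivisor X) :
    ∃ x : (Spec (.of A)).functionField, x ≠ 0 ∧
      (∀ P : PrimeDivisor (Spec (.of A)),
        (p ^ e - 1) * KY P + ⌊((p : ℚ) ^ e - 1) * Δ P⌋ ≤ Scheme.ord x P.1) ∧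
      Scheme.ord (functionFieldMap f (x * algebraMap A _ c)) E.1 + KX E < p ^ e * (KX E + 1) := by
  obtain ⟨Ψ, hΨ, hΨA, hΨc⟩ := h.exists_addMonoidHom hΔ
  have hchY : CharP (Spec (.of A)).functionField p :=
    charP_of_injective_algebraMap (IsFractionRing.injective A _) p
  have hchX : CharP X.functionField p :=
    charP_of_injective_ringHom (functionFieldMap f).injective p
  have hstY (P : Spec (.of A)) : CharP ((Spec (.of A)).presheaf.stalk P) p := charP_stalk P
  have hstX : CharP (X.presheaf.stalk E.1) p := charP_stalk E.1
  have hFX : (frobenius (X.presheaf.stalk E.1) p).Finite :=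
    frobenius_stalk_finite_of_locallyOfFiniteType f E.1 (frobenius_stalk_finite hA _)
  -- The `p`-basis at `E` serves to construct one operator; its characteristic properties allow the
  -- same operator to be used at every prime divisor of `Spec A`.
  obtain ⟨-, z, hz⟩ := exists_isPBasis_localSubring (p := p)
    (ι := RingHom.id X.functionField) Function.surjective_id E hFX
  have hC := hz.isCartierOperator
  let ι := RingEquiv.ofBijective (functionFieldMap f) (functionFieldMap_bijective f)
  have hι (g) : ι g = functionFieldMap f g := rfl
  obtain ⟨x, hx⟩ := hC.exists_iterate_mul_smul hz hη e
    ((ι.toAddMonoidHom.comp Ψ).comp ι.symm.toAddMonoidHom) (fun a g => by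
      change ι (Ψ (ι.symm (a ^ p ^ e * g))) = a * ι (Ψ (ι.symm g))
      rw [map_mul, map_pow, hΨ, map_mul, ι.apply_symm_apply])
  obtain ⟨x, rfl⟩ := ι.surjective x
  have hx' (g) : hz.cartier^[e] (functionFieldMap f (x * g) • η) =
      functionFieldMap f (Ψ g) • η := by
    have := hx (ι g)
    rw [← map_mul] at this
    rw [← hι, this]
    change ι (Ψ (ι.symm (ι g))) • η = _
    rw [ι.symm_apply_apply, hι]
  have hxc : hz.cartier^[e] (functionFieldMap f (x * algebraMap A _ c) • η) = η := by
    rw [hx', hΨc, map_one, one_smul]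
  have hx0 : x ≠ 0 := by
    rintro rfl
    rw [zero_mul, map_zero, zero_smul, Function.iterate_fixed (map_zero _)] at hxc
    exact hη hxc.symm
  refine ⟨x, hx0, fun P => ?_, ?_⟩
  · refine le_ord_of_iterate_mem (functionFieldMap_bijective f).2 hKY P
      (frobenius_stalk_finite hA _) hC e _ hx0 fun g hg hgP => ?_
    obtain ⟨s, hs⟩ := exists_algebraMap_of_le_ord hΔ hΨ hΨA P hg hgP
    exact ⟨s, by rw [hx', hs]⟩
  · exact ord_add_lt_of_iterate_eq (ι := RingHom.id X.functionField) Function.surjective_id hKX E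
      hFX hC e ((map_ne_zero _).mpr (mul_ne_zero hx0 (algebraMap_functionField_ne_zero hc))) hxc

end Descent


/-! ### Pull-back and the discrepancy estimate -/

section Discrepancy

variable {A : Type u} [CommRing A] [IsDomain A] [IsNoetherianRing A] [IsIntegrallyClosed A]
  {Δ : WeilDivisor (Spec (.of A)) ℚ}

/-- Pull-back preserves lower bounds for the divisors of rational functions. -/
theorem IsPullback.le_ord {X : Scheme.{u}} [IsIntegral X] [IsLocallyNoetherian X]
    [IsNormalScheme X] {f : X ⟶ Spec (.of A)} [IsDominant f] {D : WeilDivisor (Spec (.of A)) ℚ}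
    {D' : PrimeDivisor X → ℚ} (h : IsPullback f D D') (E : PrimeDivisor X) (n : ℕ)
    {x : (Spec (.of A)).functionField} (hx : x ≠ 0)
    (hD : ∀ P : PrimeDivisor (Spec (.of A)), (n : ℚ) * D P ≤ Scheme.ord x P.1) :
    (n : ℚ) * D' E ≤ Scheme.ord (functionFieldMap f x) E.1 := by
  obtain ⟨r, w, hr, ⟨hw, U, hy, hU⟩, hE⟩ := h E
  have hr' : (0 : ℚ) < r := by exact_mod_cast hr
  have hne : x ^ r * (w ^ n)⁻¹ ≠ 0 :=
    mul_ne_zero (pow_ne_zero _ hx) (inv_ne_zero (pow_ne_zero _ hw))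
  -- `x ^ r / w ^ n` has no poles along prime divisors meeting `U`, so by normality it is regular at
  -- `f(E)` and pulls back to a function regular along `E`.
  obtain ⟨s, hs⟩ := exists_algebraMap_of_ord_nonneg (f E.1) U hy hne fun P hP => by
    have h1 := hU P hP
    have h2 := mul_le_mul_of_nonneg_left (hD P) hr'.le
    rw [Finsupp.smul_apply, smul_eq_mul] at h1
    rw [Scheme.ord_mul (pow_ne_zero _ hx) (inv_ne_zero (pow_ne_zero _ hw)), ord_pow _ hx,
      ord_inv _ (pow_ne_zero _ hw), ord_pow _ hw]
    have h3 : (n : ℚ) * Scheme.ord w P.1 ≤ r * Scheme.ord x P.1 := by rw [← h1]; linarith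
    have h4 : (n : ℤ) * Scheme.ord w P.1 ≤ r * Scheme.ord x P.1 := by exact_mod_cast h3
    linarith
  have hιx : functionFieldMap f x ≠ 0 := (map_ne_zero _).mpr hx
  have hιw : functionFieldMap f w ≠ 0 := (map_ne_zero _).mpr hw
  have h1 := (ord_nonneg_iff E ((map_ne_zero (functionFieldMap f)).mpr hne)).mpr
    ⟨f.stalkMap E.1 s, by rw [← functionFieldMap_algebraMap, hs]⟩
  rw [map_mul, map_inv₀, map_pow, map_pow, Scheme.ord_mul (pow_ne_zero _ hιx)
    (inv_ne_zero (pow_ne_zero _ hιw)), ord_pow _ hιx, ord_inv _ (pow_ne_zero _ hιw),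
    ord_pow _ hιw] at h1
  have h2 : (n : ℚ) * Scheme.ord (functionFieldMap f w) E.1 ≤
      r * Scheme.ord (functionFieldMap f x) E.1 := by
    have : (n : ℤ) * Scheme.ord (functionFieldMap f w) E.1 ≤
      r * Scheme.ord (functionFieldMap f x) E.1 := by linarith
    exact_mod_cast this
  rw [hE, ← mul_div_assoc, div_le_iff₀ hr']
  linarith

/-- The minimal primes of `A(-⌊Δ⌋)` are the components of `⌊Δ⌋`. -/
theorem exists_eq_pointIdeal_of_mem_minimalPrimes (hΔ : 0 ≤ Δ) {𝔭 : Ideal A}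
    (h𝔭 : 𝔭 ∈ (floorIdeal Δ).minimalPrimes) :
    ∃ Q : PrimeDivisor (Spec (.of A)), roundDown Δ Q ≠ 0 ∧ 𝔭 = pointIdeal Q.1 := by
  have hprime : 𝔭.IsPrime := h𝔭.1.1
  have hrd (Q) : roundDown Δ Q = ((⌊Δ Q⌋ : ℤ) : ℚ) := by simp [roundDown]
  have hfl (Q) : 0 ≤ ⌊Δ Q⌋ := Int.floor_nonneg.mpr (hΔ Q)
  have hmem (a : A) : a ∈ floorIdeal Δ ↔ (a ≠ 0 → ∀ P : PrimeDivisor (Spec (.of A)),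
      ⌊Δ P⌋ ≤ Scheme.ord (algebraMap A (Spec (.of A)).functionField a) P.1) := by
    change (algebraMap A (Spec (.of A)).functionField a ≠ 0 → _) ↔ _
    rw [map_ne_zero_iff _ (IsFractionRing.injective A _)]
    refine forall_congr' fun _ => forall_congr' fun P => ?_
    rw [Finsupp.neg_apply, hrd, ← sub_eq_add_neg, sub_nonneg, Int.cast_le]
    rfl
  -- Otherwise each component `Q` of `⌊Δ⌋` has an element `b Q` of its ideal outside `𝔭`; the
  -- product of the powers `b Q ^ ⌊Δ Q⌋` lies in `A(-⌊Δ⌋) ⊆ 𝔭`, a contradiction.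
  obtain ⟨Q, hQ, hQ𝔭⟩ : ∃ Q : PrimeDivisor (Spec (.of A)), roundDown Δ Q ≠ 0 ∧
      pointIdeal Q.1 ≤ 𝔭 := by
    by_contra! hcon
    have hb (Q : PrimeDivisor (Spec (.of A))) :
        ∃ b, (roundDown Δ Q ≠ 0 → b ∈ pointIdeal Q.1) ∧ b ∉ 𝔭 := by
      by_cases hQ : roundDown Δ Q = 0
      · exact ⟨1, fun h => absurd hQ h, (Ideal.ne_top_iff_one _).mp hprime.ne_top⟩
      · obtain ⟨b, hb, hb'⟩ := SetLike.not_le_iff_exists.mp (hcon Q hQ)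
        exact ⟨b, fun _ => hb, hb'⟩
    choose b hb hb𝔭 using hb
    have hb0 (Q) : b Q ≠ 0 := fun h => hb𝔭 Q (h ▸ zero_mem _)
    have hbK (Q) := algebraMap_functionField_ne_zero (hb0 Q)
    have h1 : ∏ Q ∈ (roundDown Δ).support, b Q ^ (⌊Δ Q⌋).toNat ∈ floorIdeal Δ := by
      refine (hmem _).mpr fun _ P => ?_
      rw [map_prod, ord_prod _ _ _ fun Q _ => by rw [map_pow]; exact pow_ne_zero _ (hbK Q)]
      have hnn (Q) : 0 ≤ Scheme.ord (algebraMap A (Spec (.of A)).functionField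
          (b Q ^ (⌊Δ Q⌋).toNat)) P.1 := ord_algebraMap_nonneg P (pow_ne_zero _ (hb0 Q))
      by_cases hP : roundDown Δ P = 0
      · rw [hrd, Int.cast_eq_zero] at hP
        rw [hP]
        exact Finset.sum_nonneg fun Q _ => hnn Q
      · refine le_trans ?_ (Finset.single_le_sum (fun Q _ => hnn Q)
          (Finsupp.mem_support_iff.mpr hP))
        rw [map_pow, ord_pow _ (hbK P), Int.toNat_of_nonneg (hfl P)]
        exact le_mul_of_one_le_right (hfl P)
          ((ord_algebraMap_pos_iff P (hb0 P)).mpr (hb P hP))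
    obtain ⟨Q, -, hQ⟩ := hprime.prod_mem_iff.mp (h𝔭.1.2 h1)
    exact hb𝔭 Q (hprime.mem_of_pow_mem _ hQ)
  refine ⟨Q, hQ, le_antisymm (h𝔭.2 ⟨inferInstance, fun a ha => ?_⟩ hQ𝔭) hQ𝔭⟩
  rcases eq_or_ne a 0 with rfl | ha0
  · exact zero_mem _
  rw [hrd, Int.cast_ne_zero] at hQ
  have h1 := (hmem a).mp ha ha0 Q
  have h2 := hfl Q
  exact (ord_algebraMap_pos_iff Q ha0).mp (by omega)

omit [IsNoetherianRing A] [IsIntegrallyClosed A] in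
/-- Prime avoidance for points of codimension at least two. -/
theorem exists_mem_pointIdeal_notMem {y : Spec (.of A)} (hy : 2 ≤ Order.coheight y)
    (T : Finset (PrimeDivisor (Spec (.of A)))) :
    ∃ c ∈ pointIdeal y, c ≠ 0 ∧ ∀ Q ∈ T, c ∉ pointIdeal Q.1 := by
  classical
  have hy' : 2 ≤ (pointIdeal y).height := by rwa [pointIdeal_height]
  by_contra! hcon
  -- The zero ideal joins the list so that the element found is nonzero; every ideal of the list has
  -- height at most one.
  have h1 : (pointIdeal y : Set A) ⊆
      ⋃ I ∈ (insert ⊥ (T.image fun Q => pointIdeal Q.1) : Finset (Ideal A)), (I : Set A) := by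
    intro c hc
    rcases eq_or_ne c 0 with rfl | hc0
    · simp
    · obtain ⟨Q, hQ, hcQ⟩ := hcon c hc hc0
      simp only [Set.mem_iUnion]
      exact ⟨pointIdeal Q.1, by simpa using Or.inr ⟨Q, hQ, rfl⟩, hcQ⟩
  obtain ⟨I, hI, hyI⟩ := (Ideal.subset_union_prime (f := fun I : Ideal A => I) ⊥ ⊥
    (fun I hI _ _ => by
      rcases Finset.mem_insert.mp hI with rfl | hI
      · exact Ideal.isPrime_bot
      · obtain ⟨Q, -, rfl⟩ := Finset.mem_image.mp hI
        infer_instance)).mp h1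
  have h2 : (pointIdeal y).height ≤ I.height := Ideal.height_mono hyI
  rcases Finset.mem_insert.mp hI with rfl | hI
  · rw [Ideal.height_bot] at h2
    exact absurd (hy'.trans h2) (by norm_num)
  · obtain ⟨Q, -, rfl⟩ := Finset.mem_image.mp hI
    rw [pointIdeal_height Q.1, Q.2] at h2
    exact absurd (hy'.trans h2) (by norm_num)

-- The stalk map is a local homomorphism, so a nonunit at `f(E)` stays a nonunit at `E`.
omit [IsNoetherianRing A] [IsIntegrallyClosed A] in
theorem ord_functionFieldMap_pos {X : Scheme.{u}} [IsIntegral X] [IsLocallyNoetherian X]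
    [IsNormalScheme X] (f : X ⟶ Spec (.of A)) [IsDominant f] (E : PrimeDivisor X) {c : A}
    (hc : c ≠ 0) (hcE : c ∈ pointIdeal (f E.1)) :
    0 < Scheme.ord (functionFieldMap f (algebraMap A _ c)) E.1 := by
  have h0 := (map_ne_zero (functionFieldMap f)).mpr (algebraMap_functionField_ne_zero hc)
  rw [← algebraMap_toStalk (f E.1), functionFieldMap_algebraMap] at h0 ⊢
  rw [ord_pos_iff E fun h => h0 (by rw [h, map_zero])]
  intro h
  exact (isUnit_toStalk_iff _ _).mp (isUnit_of_map_unit (f.stalkMap E.1).hom _ h) hcE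

variable {p : ℕ} [Fact p.Prime] [CharP A p]
  {X : Scheme.{u}} [IsIntegral X] [IsLocallyNoetherian X] [IsNormalScheme X]
  {f : X ⟶ Spec (.of A)} [LocallyOfFiniteType f] [IsBirationalMorphism f]
  {η : TopForm X.functionField} (hη : η ≠ 0)
  {KX : WeilDivisor X ℤ} (hKX : IsCanonicalDivisor X (RingHom.id X.functionField) η KX)
  {KY : WeilDivisor (Spec (.of A)) ℤ}
  (hKY : IsCanonicalDivisor (Spec (.of A)) (functionFieldMap f) η KY)
  {fD : PrimeDivisor X → ℚ} (hfD : IsPullback f (toRat KY + Δ) fD)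

include hη hKX hKY hfD in
/-- The discrepancy estimate given by one splitting. -/
theorem FrobeniusSplits.mul_le_ord_sub_ord (hA : IsFFinite p A) (hΔ : 0 ≤ Δ) {e : ℕ} {b c : A}
    (hb : b ≠ 0) (hbΔ : ∀ P, Δ P ≠ 0 → b ∈ pointIdeal P.1)
    (hc : c ≠ 0) (h : FrobeniusSplits p Δ e c) (E : PrimeDivisor X) :
    ((p : ℚ) ^ e - 1) * (fD E - KX E - 1) ≤
      Scheme.ord (functionFieldMap f (algebraMap A _ b)) E.1 -
        Scheme.ord (functionFieldMap f (algebraMap A _ c)) E.1 := by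
  obtain ⟨x, hx, hxY, hxX⟩ := h.exists_ord_bounds hη hKX hKY hA hΔ hc E
  have hbK := algebraMap_functionField_ne_zero hb
  have hcK := algebraMap_functionField_ne_zero hc
  have hq : 1 ≤ p ^ e := Nat.one_le_pow _ _ (Fact.out : p.Prime).pos
  have h1 := hfD.le_ord E (p ^ e - 1) (mul_ne_zero hx hbK) fun P => by
    have h2 := hxY P
    have h3 : (KY P : ℚ) = toRat KY P := by simp [toRat]
    have h4 : ((p : ℚ) ^ e - 1) * Δ P ≤ ⌊((p : ℚ) ^ e - 1) * Δ P⌋ +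
        Scheme.ord (algebraMap A (Spec (.of A)).functionField b) P.1 := by
      by_cases hP : Δ P = 0
      · rw [hP, mul_zero, Int.floor_zero, Int.cast_zero, zero_add]
        exact_mod_cast ord_algebraMap_nonneg P hb
      · have h5 : (1 : ℚ) ≤ Scheme.ord (algebraMap A (Spec (.of A)).functionField b) P.1 := by
          exact_mod_cast (ord_algebraMap_pos_iff P hb).mpr (hbΔ P hP)
        linarith [Int.lt_floor_add_one (((p : ℚ) ^ e - 1) * Δ P)]
    have h6 : ((p : ℚ) ^ e - 1) * KY P + ⌊((p : ℚ) ^ e - 1) * Δ P⌋ ≤ Scheme.ord x P.1 := by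
      exact_mod_cast h2
    rw [Scheme.ord_mul hx hbK, Finsupp.add_apply, ← h3]
    push_cast [Nat.cast_sub hq]
    linarith
  have hιx := (map_ne_zero (functionFieldMap f)).mpr hx
  rw [map_mul, Scheme.ord_mul hιx ((map_ne_zero _).mpr hbK)] at h1
  rw [map_mul, Scheme.ord_mul hιx ((map_ne_zero _).mpr hcK)] at hxX
  -- The strict inequality between integers is sharpened by one; this turns the right side minus `KX
  -- E + 1` into a multiple of `q - 1`.
  have h2 : Scheme.ord (functionFieldMap f x) E.1 +
      Scheme.ord (functionFieldMap f (algebraMap A _ c)) E.1 + KX E + 1 ≤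
        (p : ℚ) ^ e * (KX E + 1) := by exact_mod_cast hxX
  push_cast [Nat.cast_sub hq] at h1
  linarith

end Discrepancy

end FPairs

end

/-! ### The discrepancy bounds -/

theorem theorem3p3 (p : ℕ) [Fact p.Prime] (A : Type u) [CommRing A] [IsDomain A]
    [IsLocalRing A] [IsNoetherianRing A] [IsIntegrallyClosed A] [CharP A p]
    (hA : FPairs.IsFFinite p A)
    (Δ : FPairs.WeilDivisor (Spec (.of A)) ℚ) (hΔ : 0 ≤ Δ)
    (X : Scheme.{u}) [IsIntegral X] [IsLocallyNoetherian X] [FPairs.IsNormalScheme X]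
    (f : X ⟶ Spec (.of A)) [IsProper f] [FPairs.IsBirationalMorphism f]
    (η : FPairs.TopForm X.functionField) (hη : η ≠ 0)
    (KX : FPairs.WeilDivisor X ℤ)
    (hKX : FPairs.IsCanonicalDivisor X (RingHom.id X.functionField) η KX)
    (KY : FPairs.WeilDivisor (Spec (.of A)) ℤ)
    (hKY : FPairs.IsCanonicalDivisor (Spec (.of A)) (FPairs.functionFieldMap f) η KY)
    (hQ : FPairs.IsQCartier (FPairs.toRat KY + Δ))
    (fD : FPairs.PrimeDivisor X → ℚ)
    (hfD : FPairs.IsPullback f (FPairs.toRat KY + Δ) fD)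
    (a : FPairs.PrimeDivisor X → ℚ)
    (ha : ∀ E : FPairs.PrimeDivisor X,
      (KX E : ℚ) + FPairs.strictTransform f Δ E = fD E + a E) :
    (FPairs.IsFPure p Δ →
      ∀ E : FPairs.PrimeDivisor X, FPairs.IsExceptional f E → -1 ≤ a E) ∧
    (FPairs.IsDivisoriallyFRegular p Δ →
      ∀ E : FPairs.PrimeDivisor X, FPairs.IsExceptional f E → -1 < a E) := by
  obtain ⟨b, hb, hbΔ⟩ := FPairs.exists_mem_pointIdeal Δ
  have haE (E : FPairs.PrimeDivisor X) (hE : FPairs.IsExceptional f E) :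
      fD E - KX E - 1 = -1 - a E := by
    have h1 : FPairs.strictTransform f Δ E = 0 := dif_neg fun h => by
      rw [FPairs.IsExceptional, h] at hE
      exact absurd hE (by norm_num)
    linarith [ha E]
  have key {e : ℕ} {c : A} (hc : c ≠ 0) (h : FPairs.FrobeniusSplits p Δ e c) :=
    h.mul_le_ord_sub_ord hη hKX hKY hfD hA hΔ hb hbΔ hc
  have hp1 : (1 : ℚ) < p := by exact_mod_cast (Fact.out : p.Prime).one_lt
  refine ⟨fun hF E hE => ?_, fun hF E hE => ?_⟩
  · by_contra! hlt
    -- If `-1 - a E > 0`, the left side of the estimate grows with `q` while `ord_E b` is fixed.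
    obtain ⟨e, he⟩ := pow_unbounded_of_one_lt
      ((Scheme.ord (FPairs.functionFieldMap f (algebraMap A _ b)) E.1 : ℚ) / (-1 - a E) + 1) hp1
    have h1 := key one_ne_zero (hF e) E
    rw [haE E hE, map_one, map_one, FPairs.ord_one, Int.cast_zero, sub_zero] at h1
    rw [← lt_sub_iff_add_lt, div_lt_iff₀ (by linarith)] at he
    linarith
  · obtain ⟨c, hcE, hc0, hc⟩ := FPairs.exists_mem_pointIdeal_notMem hE (FPairs.roundDown Δ).support
    let B : ℤ := Scheme.ord (FPairs.functionFieldMap f (algebraMap A _ b)) E.1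
    -- The exponent makes the order of this power along `E` exceed `ord_E b`. It can be fixed before
    -- `e` is known because `b` does not depend on `e`.
    obtain ⟨e, he, hs⟩ := hF (c ^ (B.toNat + 1)) (pow_ne_zero _ hc0) fun 𝔭 h𝔭 hmem => by
      obtain ⟨Q, hQ, rfl⟩ := FPairs.exists_eq_pointIdeal_of_mem_minimalPrimes hΔ h𝔭
      exact hc Q (Finsupp.mem_support_iff.mpr hQ) (h𝔭.1.1.mem_of_pow_mem _ hmem)
    have h1 := key (pow_ne_zero _ hc0) hs E
    have h2 := FPairs.ord_functionFieldMap_pos f E hc0 hcE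
    rw [haE E hE, map_pow, map_pow, FPairs.ord_pow _ ((map_ne_zero _).mpr
      (FPairs.algebraMap_functionField_ne_zero hc0))] at h1
    have h3 : B < ((B.toNat + 1 : ℕ) : ℤ) *
        Scheme.ord (FPairs.functionFieldMap f (algebraMap A _ c)) E.1 := by
      have h4 := Int.self_le_toNat B
      have h5 : ((B.toNat + 1 : ℕ) : ℤ) ≤ ((B.toNat + 1 : ℕ) : ℤ) *
        Scheme.ord (FPairs.functionFieldMap f (algebraMap A _ c)) E.1 :=
        le_mul_of_one_le_right (by positivity) h2
      push_cast at h5 ⊢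
      linarith
    have h4 : (B : ℚ) < ((B.toNat + 1 : ℕ) : ℚ) *
        Scheme.ord (FPairs.functionFieldMap f (algebraMap A _ c)) E.1 := by exact_mod_cast h3
    -- Here `e > 0` is essential: for `e = 0` the factor `q - 1` would vanish.
    have h5 : 1 < (p : ℚ) ^ e := one_lt_pow₀ hp1 he.ne'
    have h6 : ((p : ℚ) ^ e - 1) * (-1 - a E) < 0 := by
      refine h1.trans_lt ?_
      push_cast at h4 ⊢
      linarith
    have h7 := (neg_of_mul_neg_right h6 (by linarith) : -1 - a E < 0)
    linarith
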